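/- Let $N\ge 1$ and, for $k=0,\dots,N-1$, let $A_k\in\mathbb R^{n\times n}$ be invertible, $B_k\in\mathbb R^{n\times p}$, $D_k\in\mathbb R^{n\times q}$, $Q_k\in\mathbb R^{n\times n}$ with $Q_k\succeq 0$, and $R_k\in\mathbb R^{p\times p}$ with $R_k\succ 0$. Let $\bar\Sigma_0\succ 0$ and $\bar\Sigma_N\succ D_{N-1}D_{N-1}^{\mathsf T}$, and assume that the reachability Gramian $\sum_{i=0}^{N-1}\Phi_iB_iB_i^{\mathsf T}\Phi_i^{\mathsf T}$, $\Phi_i=A_{N-1}A_{N-2}\cdots A_{i+1}$ ($\Phi_{N-1}=I_n$), is positive definite. The (non-convex) covariance steering problem is $$\min_{\Sigma_k,U_k}\ \sum_{k=0}^{N-1}\operatorname{tr}(Q_k\Sigma_k)+\operatorname{tr}(R_kU_k\Sigma_k^{-1}U_k^{\mathsf T})$$ subject to $\Sigma_0=\bar\Sigma_0$, $\Sigma_N=\bar\Sigma_N$ and, for $k=0,\dots,N-1$, $\Sigma_k\succ0$ and $$A_k\Sigma_kA_k^{\mathsf T}+B_kU_kA_k^{\mathsf T}+A_kU_k^{\mathsf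 T}B_k^{\mathsf T}+B_kU_k\Sigma_k^{-1}U_k^{\mathsf T}B_k^{\mathsf T}+D_kD_k^{\mathsf T}-\Sigma_{k+1}=0 .$$ Its convex relaxation is $$\min_{\Sigma_k,U_k,Y_k}\ \sum_{k=0}^{N-1}\operatorname{tr}(Q_k\Sigma_k)+\operatorname{tr}(R_kY_k)$$ subject to $\Sigma_0=\bar\Sigma_0$, $\Sigma_N=\bar\Sigma_N$ and, for $k=0,\dots,N-1$, $\Sigma_k\succ0$, $C_k:=U_k\Sigma_k^{-1}U_k^{\mathsf T}-Y_k\preceq 0$ and $$A_k\Sigma_kA_k^{\mathsf T}+B_kU_kA_k^{\mathsf T}+A_kU_k^{\mathsf T}B_k^{\mathsf T}+B_kY_kB_k^{\mathsf T}+D_kD_k^{\mathsf T}-\Sigma_{k+1}=0 .$$ Then: 1. $(\Sigma,U,Y)$ is an optimal solution of the convex relaxation if and only if $(\Sigma,U)$ is an optimal solution of the covariance steering problem and $C_k=0$ (that is, $Y_k=U_k\Sigma_k^{-1}U_k^{\mathsf T}$) for all $k=0,\dots,N-1$. 2. If $(\Sigma,U,Y)$ is an optimal solution of the convex relaxation,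 then it is its unique optimal solution, and $(\Sigma,U)$ is the unique optimal solution of the covariance steering problem. Moreover $(\Sigma,U,Y)$ is the unique optimal solution of the semidefinite program obtained from the relaxation by replacing the constraints $\Sigma_k\succ 0$, $C_k\preceq0$ by the linear matrix inequalities $\begin{bmatrix}\Sigma_k&U_k^{\mathsf T}\\U_k&Y_k\end{bmatrix}\succeq0$. Finally, the gains $K_k=U_k\Sigma_k^{-1}$, together with $\Sigma$, are the unique minimizer of $\sum_{k=0}^{N-1}\operatorname{tr}(Q_k\Sigma_k)+\operatorname{tr}(R_kK_k\Sigma_kK_k^{\mathsf T})$ over all gains $K_0,\dots,K_{N-1}\in\mathbb R^{p\times n}$ and covariances with $\Sigma_0=\bar\Sigma_0$, $\Sigma_{k+1}=(A_k+B_kK_k)\Sigma_k(A_k+B_kK_k)^{\mathsf T}+D_kD_k^{\mathsf T}$ for $k=0,\dots,N-1$, and $\Sigma_N=\bar\Sigma_N$; so the optimal covariance steering law is computed exactly by semidefinite programming. -/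

import Mathlib

open scoped Matrix

namespace CovSteering

/-- Coefficients of the linear system `x (k+1) = A k x k + B k u k + D k w k`, cost weights, and
boundary covariances. Over a horizon of `N` steps only the entries with `k < N` are used. -/
structure SystemData (n p q : ℕ) where
  A : ℕ → Matrix (Fin n) (Fin n) ℝ
  B : ℕ → Matrix (Fin n) (Fin p) ℝ
  D : ℕ → Matrix (Fin n) (Fin q) ℝ
  Q : ℕ → Matrix (Fin n) (Fin n) ℝ
  R : ℕ → Matrix (Fin p) (Fin p) ℝ
  /-- the given initial covariance -/
  cov0 : Matrix (Fin n) (Fin n) ℝ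
  /-- the prescribed terminal covariance -/
  covN : Matrix (Fin n) (Fin n) ℝ

/-- The state transition matrix from time `l` to time `k`, for `l ≤ k`:
`A (k-1) * A (k-2) * ⋯ * A l`, and the identity when `k = l`. -/
def transition {n : ℕ} (A : ℕ → Matrix (Fin n) (Fin n) ℝ) (l : ℕ) :
    ℕ → Matrix (Fin n) (Fin n) ℝ
  | 0 => 1
  | k + 1 => if l ≤ k then A k * transition A l k else 1

/-- The reachability Gramian from time `0` to time `N`. -/
def gramian {n p q : ℕ} (d : SystemData n p q) (N : ℕ) : Matrix (Fin n) (Fin n) ℝ :=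
  ∑ i ∈ Finset.range N,
    transition d.A (i + 1) N * d.B i * (d.B i)ᵀ * (transition d.A (i + 1) N)ᵀ

/-- State covariances at the times `0, …, N`. -/
abbrev CovSeq (n N : ℕ) : Type := Fin (N + 1) → Matrix (Fin n) (Fin n) ℝ

/-- Matrices of size `p × n` at the times `0, …, N - 1`: the variables `U k`, or gains `K k`. -/
abbrev InputSeq (n p N : ℕ) : Type := Fin N → Matrix (Fin p) (Fin n) ℝ

/-- Matrices of size `p × p` at the times `0, …, N - 1`: the relaxation variables `Y k`. -/
abbrev SlackSeq (p N : ℕ) : Type := Fin N → Matrix (Fin p) (Fin p) ℝ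

/-- `z` is an optimal solution of the problem of minimizing `J` over the feasible set `F`. -/
def IsOptimal {α : Type*} (F : Set α) (J : α → ℝ) (z : α) : Prop :=
  z ∈ F ∧ IsMinOn J F z

section Problems

variable {n p q : ℕ} (d : SystemData n p q) (N : ℕ)

/-! ### The non-convex covariance steering problem, variables `(S, U)` -/

def steeringFeasible : Set (CovSeq n N × InputSeq n p N) :=
  {z | z.1 0 = d.cov0 ∧ z.1 (Fin.last N) = d.covN ∧
    ∀ k : Fin N, (z.1 k.castSucc).PosDef ∧
      d.A k * z.1 k.castSucc * (d.A k)ᵀ + d.B k * z.2 k * (d.A k)ᵀ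
        + d.A k * (z.2 k)ᵀ * (d.B k)ᵀ
        + d.B k * z.2 k * (z.1 k.castSucc)⁻¹ * (z.2 k)ᵀ * (d.B k)ᵀ
        + d.D k * (d.D k)ᵀ - z.1 k.succ = 0}

noncomputable def steeringCost (z : CovSeq n N × InputSeq n p N) : ℝ :=
  ∑ k : Fin N, ((d.Q k * z.1 k.castSucc).trace
    + (d.R k * z.2 k * (z.1 k.castSucc)⁻¹ * (z.2 k)ᵀ).trace)

/-! ### The convex relaxation, variables `(S, U, Y)` -/

/-- The affine constraints of the relaxation: the boundary values and the covariance equation. -/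
def RelaxedDynamics (z : CovSeq n N × InputSeq n p N × SlackSeq p N) : Prop :=
  z.1 0 = d.cov0 ∧ z.1 (Fin.last N) = d.covN ∧
    ∀ k : Fin N,
      d.A k * z.1 k.castSucc * (d.A k)ᵀ + d.B k * z.2.1 k * (d.A k)ᵀ
        + d.A k * (z.2.1 k)ᵀ * (d.B k)ᵀ
        + d.B k * z.2.2 k * (d.B k)ᵀ
        + d.D k * (d.D k)ᵀ - z.1 k.succ = 0

/-- The matrix `C k = U k (S k)⁻¹ (U k)ᵀ - Y k`. -/
noncomputable def gap {n p N : ℕ} (z : CovSeq n N × InputSeq n p N × SlackSeq p N) (k : Fin N) :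
    Matrix (Fin p) (Fin p) ℝ :=
  z.2.1 k * (z.1 k.castSucc)⁻¹ * (z.2.1 k)ᵀ - z.2.2 k

/-- Feasible set of the relaxation: `S k ≻ 0`, `C k ⪯ 0`, and the affine constraints. -/
def relaxedFeasible : Set (CovSeq n N × InputSeq n p N × SlackSeq p N) :=
  {z | RelaxedDynamics d N z ∧
    ∀ k : Fin N, (z.1 k.castSucc).PosDef ∧ (-(gap z k)).PosSemidef}

/-- The same relaxation as a standard semidefinite program: the constraints `S k ≻ 0`, `C k ⪯ 0`
are replaced by a (closed) linear matrix inequality. -/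
def sdpFeasible : Set (CovSeq n N × InputSeq n p N × SlackSeq p N) :=
  {z | RelaxedDynamics d N z ∧
    ∀ k : Fin N,
      (Matrix.fromBlocks (z.1 k.castSucc) (z.2.1 k)ᵀ (z.2.1 k) (z.2.2 k)).PosSemidef}

def relaxedCost (z : CovSeq n N × InputSeq n p N × SlackSeq p N) : ℝ :=
  ∑ k : Fin N, ((d.Q k * z.1 k.castSucc).trace + (d.R k * z.2.2 k).trace)

/-! ### Steering laws: gains `K k` of the feedback `u k = K k (x k - μ k) + v k` -/

/-- Pairs of a gain sequence and the covariance sequence it produces from `cov0`, such that the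
terminal covariance is `covN`. -/
def lawFeasible : Set (CovSeq n N × InputSeq n p N) :=
  {z | z.1 0 = d.cov0 ∧ z.1 (Fin.last N) = d.covN ∧
    ∀ k : Fin N, z.1 k.succ =
      (d.A k + d.B k * z.2 k) * z.1 k.castSucc * (d.A k + d.B k * z.2 k)ᵀ
        + d.D k * (d.D k)ᵀ}

def lawCost (z : CovSeq n N × InputSeq n p N) : ℝ :=
  ∑ k : Fin N, ((d.Q k * z.1 k.castSucc).trace
    + (d.R k * z.2 k * z.1 k.castSucc * (z.2 k)ᵀ).trace)

end Problems

end CovSteering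

/-! Collect each stage into one block `Z k = [S k, (U k)ᵀ; U k, Y k]`. With `F k = [A k, B k]`, the
dynamics become `S (k+1) = F k * Z k * (F k)ᵀ + D k * (D k)ᵀ`, and the relaxation becomes a linear
program over the semidefinite cone. Lagrange multipliers should force the range of an optimal block
to be a graph over the state. Then `Y = U S⁻¹ Uᵀ`, and the block is determined by `S`, so forward
propagation from `cov0` gives uniqueness.

Two obstacles remain. Slater's condition can fail, so multipliers are sought only on a face: with `W
k` the set of `w` such that `Z k (F k)ᵀ w = 0` for every feasible `Z`, all feasible blocks live on
the complement of `(F k)ᵀ W k`. Separation (`exists_multiplier_of_isOpen_cone`,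
`exists_face_multiplier`) yields a cost multiplier `μ` and symmetric `Λ`, and the structure of `W k`
excludes `μ = 0` (`exists_optimal_face`). Invertibility of `A k` and `R k ≻ 0` then give the graph
property.

Secondly, the closed program might have an optimum with singular `S k`. A dimension count
(`optimal_blocks`) shows that a null direction of `S (k+1)` would lie in `W k`, hence be null for
every feasible point, against a feasible point with positive definite covariances.

An optimum exists by compactness (`exists_isOptimal_blocks`). It lies in the relaxation and has zero
gap, so the steering and gain problems, whose points lift to the semidefinite program at equal cost,
share it. -/

namespace CovSteering

/-! ### Separation for conic programs -/

/-- Separation of the optimal value of a conic program over an open convex cone. -/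
theorem exists_multiplier_of_isOpen_cone {V W : Type*} [AddCommGroup V] [Module ℝ V]
    [TopologicalSpace V] [IsTopologicalAddGroup V] [ContinuousSMul ℝ V]
    [AddCommGroup W] [Module ℝ W] [TopologicalSpace W] [IsTopologicalAddGroup W]
    [ContinuousSMul ℝ W] [T2Space W] [FiniteDimensional ℝ W]
    (L : V →ₗ[ℝ] W) (c : V →ₗ[ℝ] ℝ) (O : Set V) (hO : IsOpen O) (hconv : Convex ℝ O)
    (hcone : ∀ t : ℝ, 0 < t → ∀ z ∈ O, t • z ∈ O) (hne : O.Nonempty) (z₀ : V)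
    (hmin : ∀ z ∈ O, L z = L z₀ → c z₀ ≤ c z) :
    ∃ (μ : ℝ) (l : W →ₗ[ℝ] ℝ), 0 ≤ μ ∧ (∀ z ∈ O, 0 ≤ μ * c z + l (L z)) ∧
      μ * c z₀ + l (L z₀) ≤ 0 ∧ (μ = 0 → ∀ z ∈ O, l (L z₀) < l (L z)) := by
  -- The image of `O × (0, ∞)` consists of constraint values paired with costs strictly above
  -- attainable ones. It is convex, open in the range of `Ψ`, and misses the image of `(z₀, 0)` by
  -- minimality. Separating inside the range avoids assuming `L` surjective.
  let Ψ : V × ℝ →ₗ[ℝ] W × ℝ :=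
    (L ∘ₗ LinearMap.fst ℝ V ℝ).prod (c ∘ₗ LinearMap.fst ℝ V ℝ + LinearMap.snd ℝ V ℝ)
  have hΨ : ∀ z r, Ψ (z, r) = (L z, c z + r) := fun z r => rfl
  have hopen : IsOpenMap Ψ.rangeRestrict :=
    LinearMap.isOpenMap_of_finiteDimensional _ Ψ.surjective_rangeRestrict
  have hT := hopen _ (hO.prod (isOpen_Ioi (a := (0 : ℝ))))
  have hTc : Convex ℝ (Ψ.rangeRestrict '' (O ×ˢ Set.Ioi (0 : ℝ))) :=
    (hconv.prod (convex_Ioi 0)).linear_image _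
  obtain ⟨f, hf⟩ := geometric_hahn_banach_point_open (x := Ψ.rangeRestrict (z₀, 0)) hTc hT (by
    rintro ⟨⟨z, r⟩, ⟨hz, hr⟩, h⟩
    have h' : Ψ (z, r) = Ψ (z₀, 0) := congrArg Subtype.val h
    rw [hΨ, hΨ, Prod.mk.injEq] at h'
    have h1 := hmin z hz h'.1
    have h2 : 0 < r := hr
    linarith [h'.2])
  obtain ⟨g, hg⟩ := LinearMap.exists_extend (f : Ψ.range →ₗ[ℝ] ℝ)
  have hfg : ∀ x, f (Ψ.rangeRestrict x) = g (Ψ x) := fun x =>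
    (LinearMap.congr_fun hg (Ψ.rangeRestrict x)).symm
  set μ := g (0, 1) with hμ
  let l : W →ₗ[ℝ] ℝ := g ∘ₗ LinearMap.inl ℝ W ℝ
  have hgl : ∀ w s, g (w, s) = l w + μ * s := by
    intro w s
    have : ((w, s) : W × ℝ) = (w, 0) + s • (0, 1) := by simp
    rw [this, map_add, map_smul, smul_eq_mul, mul_comm]
    rfl
  have key : ∀ z ∈ O, ∀ r : ℝ, 0 < r →
      μ * c z₀ + l (L z₀) < (μ * c z + l (L z)) + μ * r := by
    intro z hz r hr
    have := hf _ ⟨(z, r), ⟨hz, hr⟩, rfl⟩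
    rw [hfg, hfg, hΨ, hΨ, hgl, hgl] at this
    linarith
  set K := μ * c z₀ + l (L z₀) with hK
  obtain ⟨z₁, hz₁⟩ := hne
  have hμ0 : 0 ≤ μ := by
    by_contra! hneg
    set φ := μ * c z₁ + l (L z₁)
    -- The slack is chosen so that `μ * r = -(|φ - K| + 1)`, pushing the right side of `key` below
    -- `K`.
    have hr : 0 < (|φ - K| + 1) / (-μ) := div_pos (by positivity) (by linarith)
    have h := key z₁ hz₁ _ hr
    have hne' := hneg.ne
    have : μ * ((|φ - K| + 1) / (-μ)) = -(|φ - K| + 1) := by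
      field_simp
    rw [this] at h
    linarith [le_abs_self (φ - K)]
  have scale : ∀ z ∈ O, ∀ t : ℝ, 0 < t → ∀ r : ℝ, 0 < r →
      K < t * (μ * c z + l (L z)) + μ * r := by
    intro z hz t ht r hr
    have := key (t • z) (hcone t ht z hz) r hr
    simp only [map_smul, smul_eq_mul] at this
    linarith
  refine ⟨μ, l, hμ0, ?_, ?_, ?_⟩
  · intro z hz
    by_contra! hneg
    set φ := μ * c z + l (L z)
    have ht : 0 < (|μ - K| + 1) / (-φ) := div_pos (by positivity) (by linarith)
    have h := scale z hz _ ht 1 one_pos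
    have hne' := hneg.ne
    have : (|μ - K| + 1) / (-φ) * φ = -(|μ - K| + 1) := by
      field_simp
    rw [this] at h
    linarith [le_abs_self (μ - K)]
  · by_contra! hpos
    set φ := μ * c z₁ + l (L z₁)
    -- Small enough that the scaling factor and the slack, both equal to this number, contribute at
    -- most `K / 2`.
    have hs : 0 < K / (2 * (|φ + μ| + 1)) := by positivity
    have h := scale z₁ hz₁ _ hs _ hs
    have h2 : K / (2 * (|φ + μ| + 1)) * (|φ + μ| + 1) = K / 2 := by
      field_simp
    have h3 := mul_le_mul_of_nonneg_left (le_abs_self (φ + μ)) hs.le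
    linarith
  · intro h0 z hz
    have := key z hz 1 one_pos
    simp only [hK, h0, zero_mul, zero_add] at this
    linarith

/-! ### Semidefinite matrices, traces and projections -/

/-- Positivity of the quadratic form need only be tested on the compact unit sphere, where it
survives small perturbations. Symmetrizing gives a set that is open among all matrices, not merely
among symmetric ones. -/
theorem isOpen_posDef_add_transpose {m : Type*} [Fintype m] :
    IsOpen {X : Matrix m m ℝ | (X + Xᵀ).PosDef} := by
  have hiff : ∀ X : Matrix m m ℝ, (X + Xᵀ).PosDef ↔
      ∀ y ∈ Metric.sphere (0 : m → ℝ) 1, 0 < y ⬝ᵥ ((X + Xᵀ) *ᵥ y) := by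
    intro X
    constructor
    · intro h y hy
      have hy0 : y ≠ 0 := by
        rintro rfl
        simp at hy
      simpa using h.dotProduct_mulVec_pos hy0
    · intro h
      refine Matrix.PosDef.of_dotProduct_mulVec_pos ?_ ?_
      · rw [Matrix.IsHermitian, Matrix.conjTranspose_eq_transpose_of_trivial]
        simp [add_comm]
      · intro x hx
        have hn : 0 < ‖x‖ := norm_pos_iff.mpr hx
        have := h (‖x‖⁻¹ • x) (by simp [norm_smul, hn.ne'])
        rw [Matrix.mulVec_smul, smul_dotProduct, dotProduct_smul, smul_smul, smul_eq_mul] at this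
        simpa using pos_of_mul_pos_right this (by positivity)
  rw [isOpen_iff_mem_nhds]
  intro X hX
  have hX' := (hiff X).mp hX
  have hev := (isCompact_sphere (0 : m → ℝ) 1).eventually_forall_of_forall_eventually
    (x₀ := X) (P := fun X y => 0 < y ⬝ᵥ ((X + Xᵀ) *ᵥ y)) (by
      intro y hy
      have hc : Continuous fun z : Matrix m m ℝ × (m → ℝ) =>
          z.2 ⬝ᵥ ((z.1 + z.1ᵀ) *ᵥ z.2) := by fun_prop
      exact hc.continuousAt.eventually (lt_mem_nhds (hX' y hy)))
  filter_upwards [hev] with X hX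
  exact (hiff X).mpr hX

theorem exists_eq_transpose_mul_self {m : Type*} [Fintype m] {A : Matrix m m ℝ}
    (hA : A.PosSemidef) : ∃ C : Matrix m m ℝ, A = Cᵀ * C := by
  classical
  open scoped MatrixOrder in
  obtain ⟨B, hB⟩ := CStarAlgebra.nonneg_iff_eq_star_mul_self.mp hA.nonneg
  exact ⟨B, by simpa [Matrix.star_eq_conjTranspose] using hB⟩

theorem trace_transpose_mul_self_eq {m m' : Type*} [Fintype m] [Fintype m']
    (C D : Matrix m' m ℝ) :
    (Cᵀ * C * (Dᵀ * D)).trace = ((C * Dᵀ)ᵀ * (C * Dᵀ)).trace := by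
  rw [Matrix.transpose_mul, Matrix.transpose_transpose, ← Matrix.mul_assoc,
    Matrix.trace_mul_comm (_ * Dᵀ) D]
  simp only [Matrix.mul_assoc]

theorem trace_mul_nonneg {m : Type*} [Fintype m] {A B : Matrix m m ℝ}
    (hA : A.PosSemidef) (hB : B.PosSemidef) : 0 ≤ (A * B).trace := by
  obtain ⟨C, rfl⟩ := exists_eq_transpose_mul_self hA
  obtain ⟨D, rfl⟩ := exists_eq_transpose_mul_self hB
  rw [trace_transpose_mul_self_eq]
  simpa using (Matrix.posSemidef_conjTranspose_mul_self (C * Dᵀ)).trace_nonneg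

theorem mul_eq_zero_of_trace_mul_eq_zero {m : Type*} [Fintype m]
    {A B : Matrix m m ℝ}
    (hA : A.PosSemidef) (hB : B.PosSemidef) (h : (A * B).trace = 0) : A * B = 0 := by
  obtain ⟨C, rfl⟩ := exists_eq_transpose_mul_self hA
  obtain ⟨D, rfl⟩ := exists_eq_transpose_mul_self hB
  rw [trace_transpose_mul_self_eq] at h
  have h0 : C * Dᵀ = 0 := by
    apply Matrix.trace_conjTranspose_mul_self_eq_zero_iff.mp
    simpa using h
  calc Cᵀ * C * (Dᵀ * D) = Cᵀ * (C * Dᵀ) * D := by simp only [Matrix.mul_assoc]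
    _ = 0 := by simp [h0]

/-- The orthogonal projection along a subspace, as a matrix. -/
theorem exists_projection_matrix {m : Type*} [Fintype m] [DecidableEq m]
    (K : Submodule ℝ (m → ℝ)) :
    ∃ P : Matrix m m ℝ, Pᵀ = P ∧ P * P = P ∧ ∀ x, P *ᵥ x = 0 ↔ x ∈ K := by
  let K' : Submodule ℝ (EuclideanSpace ℝ m) :=
    K.comap (WithLp.linearEquiv 2 ℝ (m → ℝ)).toLinearMap
  let T := K'ᗮ.starProjection
  let e := Matrix.toEuclideanCLM (n := m) (𝕜 := ℝ)
  have heT : e (e.symm T) = T := e.apply_symm_apply T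
  refine ⟨e.symm T, ?_, ?_, ?_⟩
  · have h : star T = T := isSelfAdjoint_starProjection _
    have h2 : star (e.symm T) = e.symm T := by
      conv_rhs => rw [← h]
      exact (e.symm.map_star' T).symm
    rwa [Matrix.star_eq_conjTranspose, Matrix.conjTranspose_eq_transpose_of_trivial] at h2
  · rw [← map_mul]
    congr 1
    exact K'ᗮ.isIdempotentElem_starProjection
  · intro x
    have h1 : T (WithLp.toLp 2 x) = WithLp.toLp 2 ((e.symm T) *ᵥ x) := by
      conv_lhs => rw [← heT]
      exact Matrix.toEuclideanCLM_toLp _ _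
    have h2 : T (WithLp.toLp 2 x) = 0 ↔ WithLp.toLp 2 x ∈ K' := by
      rw [Submodule.starProjection_apply_eq_zero_iff, Submodule.orthogonal_orthogonal]
    rw [h1] at h2
    have h3 : WithLp.toLp 2 x ∈ K' ↔ x ∈ K := Iff.rfl
    rw [← h3, ← h2]
    exact (WithLp.toLp_eq_zero 2).symm

/-- Linear functionals on tuples of symmetric matrices are trace pairings. -/
theorem exists_trace_representation {ι m : Type*} [Fintype ι] [DecidableEq ι] [Fintype m]
    [DecidableEq m] (l : (ι → Matrix m m ℝ) →ₗ[ℝ] ℝ) :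
    ∃ Λ : ι → Matrix m m ℝ, (∀ j, (Λ j)ᵀ = Λ j) ∧
      ∀ r : ι → Matrix m m ℝ, (∀ j, (r j)ᵀ = r j) → l r = ∑ j, (Λ j * r j).trace := by
  let Γ : ι → Matrix m m ℝ := fun j => Matrix.of fun a b => l (Pi.single j (Matrix.single b a 1))
  have hΓ : ∀ r : ι → Matrix m m ℝ, l r = ∑ j, (Γ j * r j).trace := by
    intro r
    conv_lhs => rw [← Finset.univ_sum_single r]
    rw [map_sum]
    refine Finset.sum_congr rfl fun j _ => ?_
    conv_lhs => rw [Matrix.matrix_eq_sum_single (r j)]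
    have : ∀ X : Matrix m m ℝ, l (Pi.single j X) = (l ∘ₗ LinearMap.single ℝ _ j) X := fun _ => rfl
    rw [this]
    simp only [map_sum, Matrix.trace, Matrix.diag, Matrix.mul_apply]
    rw [Finset.sum_comm]
    refine Finset.sum_congr rfl fun a _ => Finset.sum_congr rfl fun b _ => ?_
    have h2 : Matrix.single b a (r j b a) = r j b a • Matrix.single b a (1 : ℝ) := by simp
    rw [h2, map_smul, smul_eq_mul, mul_comm]
    rfl
  refine ⟨fun j => (1 / 2 : ℝ) • (Γ j + (Γ j)ᵀ), fun j => ?_, fun r hr => ?_⟩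
  · simp [add_comm]
  · rw [hΓ]
    refine Finset.sum_congr rfl fun j _ => ?_
    have : ((Γ j)ᵀ * r j).trace = (Γ j * r j).trace := by
      rw [← Matrix.trace_transpose, Matrix.transpose_mul, hr, Matrix.transpose_transpose,
        Matrix.trace_mul_comm]
    rw [Matrix.smul_mul, Matrix.trace_smul, Matrix.add_mul, Matrix.trace_add, this, smul_eq_mul]
    ring

/-! ### Multipliers on a face of the semidefinite cone -/

/-- Multipliers for a semidefinite program whose feasible points all lie on the face
`{Z | P k * Z k * P k = Z k}`. -/
theorem exists_face_multiplier {κ m W : Type*} [Fintype κ] [Fintype m] [DecidableEq m]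
    [AddCommGroup W] [Module ℝ W] [TopologicalSpace W] [IsTopologicalAddGroup W]
    [ContinuousSMul ℝ W] [T2Space W] [FiniteDimensional ℝ W]
    (L : (κ → Matrix m m ℝ) →ₗ[ℝ] W) (c : (κ → Matrix m m ℝ) →ₗ[ℝ] ℝ) (b : W)
    (P : κ → Matrix m m ℝ) (hPt : ∀ k, (P k)ᵀ = P k)
    (hP : ∀ Z, (∀ k, (Z k).PosSemidef) → L Z = b → ∀ k, P k * Z k * P k = Z k)
    (Z₀ : κ → Matrix m m ℝ) (hZ₀ : ∀ k, (Z₀ k).PosSemidef) (hL₀ : L Z₀ = b)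
    (hmin : ∀ Z, (∀ k, (Z k).PosSemidef) → L Z = b → c Z₀ ≤ c Z) :
    ∃ (μ : ℝ) (l : W →ₗ[ℝ] ℝ), 0 ≤ μ ∧
      (∀ Z : κ → Matrix m m ℝ, (∀ k, (Z k).PosSemidef) →
        0 ≤ μ * c (fun k => P k * Z k * P k) + l (L (fun k => P k * Z k * P k))) ∧
      (∀ Z, (∀ k, (Z k).PosSemidef) → L Z = b → (μ = 0 ∨ c Z ≤ c Z₀) →
        μ * c Z + l (L Z) = 0) ∧
      (μ = 0 → 0 < l (L (fun k => P k * P k))) := by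
  -- `T` parametrizes the face by unrestricted matrices, so the separation result applies on an open
  -- cone. A symmetric `Z` is reached from `(1/2) • Z`.
  let T : (κ → Matrix m m ℝ) →ₗ[ℝ] (κ → Matrix m m ℝ) :=
    { toFun := fun X k => P k * (X k + (X k)ᵀ) * P k
      map_add' := by
        intro X Y
        ext1 k
        simp only [Pi.add_apply, Matrix.transpose_add, mul_add, add_mul]
        abel
      map_smul' := by
        intro t X
        ext1 k
        simp [← smul_add] }
  let O : Set (κ → Matrix m m ℝ) := {X | ∀ k, (X k + (X k)ᵀ).PosDef}
  have hO : IsOpen O := by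
    have : O = ⋂ k, (fun X : κ → Matrix m m ℝ => X k) ⁻¹' {X | (X + Xᵀ).PosDef} := by
      ext X
      simp [O]
    rw [this]
    exact isOpen_iInter_of_finite fun k => isOpen_posDef_add_transpose.preimage
      (continuous_apply k)
  have hconv : Convex ℝ O := by
    intro X hX Y hY a b' ha hb hab k
    have h : (a • X + b' • Y) k + ((a • X + b' • Y) k)ᵀ =
        a • (X k + (X k)ᵀ) + b' • (Y k + (Y k)ᵀ) := by
      simp only [Pi.add_apply, Pi.smul_apply, Matrix.transpose_add, Matrix.transpose_smul,
        smul_add]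
      abel
    rw [h]
    rcases ha.eq_or_lt with rfl | ha'
    · rw [zero_add] at hab
      simpa [hab] using hY k
    · exact ((hX k).smul ha').add_posSemidef ((hY k).posSemidef.smul hb)
  have hcone : ∀ t : ℝ, 0 < t → ∀ X ∈ O, t • X ∈ O := by
    intro t ht X hX k
    have : (t • X) k + ((t • X) k)ᵀ = t • (X k + (X k)ᵀ) := by simp
    rw [this]
    exact (hX k).smul ht
  have hT : ∀ Z : κ → Matrix m m ℝ, (∀ k, (Z k).PosSemidef) →
      T ((1 / 2 : ℝ) • Z) = fun k => P k * Z k * P k := by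
    intro Z hZ
    ext1 k
    have h1 : (Z k)ᵀ = Z k := by
      simpa [Matrix.IsHermitian, Matrix.conjTranspose_eq_transpose_of_trivial] using
        (hZ k).isHermitian
    change P k * (((1 / 2 : ℝ) • Z) k + (((1 / 2 : ℝ) • Z) k)ᵀ) * P k = _
    rw [Pi.smul_apply, Matrix.transpose_smul, h1, ← add_smul]
    norm_num
  have hTZ₀ : T ((1 / 2 : ℝ) • Z₀) = Z₀ := by
    rw [hT Z₀ hZ₀]
    exact funext (hP Z₀ hZ₀ hL₀)
  have hTO : ∀ X ∈ O, ∀ k, (T X k).PosSemidef := by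
    intro X hX k
    have := (hX k).posSemidef.mul_mul_conjTranspose_same (P k)
    rwa [Matrix.conjTranspose_eq_transpose_of_trivial, hPt] at this
  have hone : ((1 / 2 : ℝ) • (1 : κ → Matrix m m ℝ)) ∈ O := by
    intro k
    have : ((1 / 2 : ℝ) • (1 : κ → Matrix m m ℝ)) k +
        (((1 / 2 : ℝ) • (1 : κ → Matrix m m ℝ)) k)ᵀ = 1 := by
      simp only [Pi.smul_apply, Pi.one_apply, Matrix.transpose_smul, Matrix.transpose_one,
        ← add_smul]
      norm_num
    rw [this]
    exact Matrix.PosDef.one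
  have hT1 : T ((1 / 2 : ℝ) • (1 : κ → Matrix m m ℝ)) = fun k => P k * P k := by
    rw [hT 1 fun k => Matrix.PosSemidef.one]
    simp
  obtain ⟨μ, l, hμ, hnn, hle, hstrict⟩ := exists_multiplier_of_isOpen_cone (L ∘ₗ T) (c ∘ₗ T) O hO
    hconv hcone ⟨_, hone⟩ ((1 / 2 : ℝ) • Z₀) (by
      intro X hX h
      simp only [LinearMap.comp_apply, hTZ₀] at h ⊢
      exact hmin _ (hTO X hX) (h.trans hL₀))
  simp only [LinearMap.comp_apply, hTZ₀, hL₀] at hnn hle hstrict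
  have hface : ∀ Z : κ → Matrix m m ℝ, (∀ k, (Z k).PosSemidef) →
      0 ≤ μ * c (fun k => P k * Z k * P k) + l (L (fun k => P k * Z k * P k)) := by
    intro Z hZ
    set φ := μ * c (fun k => P k * Z k * P k) + l (L (fun k => P k * Z k * P k)) with hφ
    set ψ := μ * c (fun k => P k * P k) + l (L (fun k => P k * P k)) with hψ
    -- Separation gives nonnegativity only on the open cone; perturbing by a multiple of the
    -- identity and letting `ε` shrink extends it to semidefinite `Z`.
    have key : ∀ ε : ℝ, 0 < ε → 0 ≤ φ + ε * ψ := by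
      intro ε hε
      have hmem : (1 / 2 : ℝ) • Z + ε • ((1 / 2 : ℝ) • (1 : κ → Matrix m m ℝ)) ∈ O := by
        intro k
        have h1 := hcone ε hε _ hone k
        have h2 : (((1 / 2 : ℝ) • Z) k + (((1 / 2 : ℝ) • Z) k)ᵀ).PosSemidef :=
          have h4 := (hZ k).smul (by norm_num : (0 : ℝ) ≤ 1 / 2)
          h4.add h4.transpose
        have h3 := h1.add_posSemidef h2
        rw [Pi.add_apply, Matrix.transpose_add]
        convert h3 using 1
        abel
      have := hnn _ hmem
      rw [T.map_add, T.map_smul ε, hT1, hT Z hZ] at this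
      simp only [map_add, map_smul, smul_eq_mul] at this
      rw [hφ, hψ]
      linarith
    by_contra! hneg
    have h := key (-φ / (2 * (|ψ| + 1))) (div_pos (by linarith) (by positivity))
    have h2 : -φ / (2 * (|ψ| + 1)) * (|ψ| + 1) = -φ / 2 := by field_simp
    have h3 := mul_le_mul_of_nonneg_left (le_abs_self ψ)
      (div_pos (neg_pos.mpr hneg) (by positivity : 0 < 2 * (|ψ| + 1))).le
    have h4 : 0 < -φ / (2 * (|ψ| + 1)) := div_pos (by linarith) (by positivity)
    linarith
  have hfeas : ∀ Z, (∀ k, (Z k).PosSemidef) → L Z = b → 0 ≤ μ * c Z + l b := by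
    intro Z hZ hLZ
    have := hface Z hZ
    rwa [funext (hP Z hZ hLZ), hLZ] at this
  refine ⟨μ, l, hμ, hface, ?_, ?_⟩
  · intro Z hZ hLZ hor
    rw [hLZ]
    refine le_antisymm (le_trans ?_ hle) (hfeas Z hZ hLZ)
    rcases hor with rfl | hle'
    · simp
    · linarith [mul_le_mul_of_nonneg_left hle' hμ]
  · intro h0
    have h1 := hstrict h0 _ hone
    rw [hT1] at h1
    have h2 := hfeas Z₀ hZ₀ hL₀
    rw [h0, zero_mul, zero_add] at h2
    linarith

/-! ### Stage blocks, covariance balance and the Lagrangian -/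

section Blocks

variable {n p q : ℕ} (d : SystemData n p q) (N : ℕ)

/-- Stage variables `[S k, (U k)ᵀ; U k, Y k]` at the times `0, …, N - 1`. -/
abbrev BlockSeq (n p N : ℕ) : Type := Fin N → Matrix (Fin n ⊕ Fin p) (Fin n ⊕ Fin p) ℝ

/-- The matrix `[A k, B k]`. -/
def dyn (k : ℕ) : Matrix (Fin n) (Fin n ⊕ Fin p) ℝ := Matrix.fromCols (d.A k) (d.B k)

/-- The matrix `[1, 0]`. -/
def stateSel (n p : ℕ) : Matrix (Fin n) (Fin n ⊕ Fin p) ℝ := Matrix.fromCols 1 0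

/-- The weight `diag (Q k, R k)`. -/
def stageWeight (k : ℕ) : Matrix (Fin n ⊕ Fin p) (Fin n ⊕ Fin p) ℝ :=
  Matrix.fromBlocks (d.Q k) 0 0 (d.R k)

/-- State covariances read off from stage variables, with the prescribed terminal value. -/
def blockCov (Z : BlockSeq n p N) : CovSeq n N :=
  Fin.lastCases d.covN fun k => (Z k).toBlocks₁₁

def blockFeasible : Set (BlockSeq n p N) :=
  {Z | (∀ k, (Z k).PosSemidef) ∧ blockCov d N Z 0 = d.cov0 ∧
    ∀ k : Fin N, blockCov d N Z k.succ =
      dyn d k * Z k * (dyn d k)ᵀ + d.D k * (d.D k)ᵀ}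

def blockCost : BlockSeq n p N →ₗ[ℝ] ℝ where
  toFun Z := ∑ k : Fin N, (stageWeight d k * Z k).trace
  map_add' := by
    intro X Y
    simp [mul_add, Finset.sum_add_distrib]
  map_smul' := by
    intro t X
    simp [Finset.mul_sum]

/-- Covariance at each time minus the covariance propagated from the previous stage. -/
def balance : BlockSeq n p N →ₗ[ℝ] (Fin (N + 1) → Matrix (Fin n) (Fin n) ℝ) where
  toFun Z j := ∑ k : Fin N, ((if j = k.castSucc then (1 : ℝ) else 0) •
      (stateSel n p * Z k * (stateSel n p)ᵀ) -
    (if j = k.succ then (1 : ℝ) else 0) • (dyn d k * Z k * (dyn d k)ᵀ))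
  map_add' := by
    intro X Y
    ext1 j
    simp only [Pi.add_apply, Matrix.mul_add, Matrix.add_mul, smul_add, ← Finset.sum_add_distrib]
    exact Finset.sum_congr rfl fun k _ => by abel
  map_smul' := by
    intro t X
    ext1 j
    simp only [Pi.smul_apply, Matrix.mul_smul, Matrix.smul_mul, Finset.smul_sum, RingHom.id_apply,
      smul_sub]
    exact Finset.sum_congr rfl fun k _ => by congr 1 <;> exact smul_comm _ _ _

/-- The value of `balance` prescribed by the boundary covariances and the noise. -/
def balanceTarget : Fin (N + 1) → Matrix (Fin n) (Fin n) ℝ := fun j =>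
  (if j = 0 then d.cov0 else 0) +
    ∑ k : Fin N, (if j = k.succ then (1 : ℝ) else 0) • (d.D k * (d.D k)ᵀ) -
    (if j = Fin.last N then d.covN else 0)

variable {d N}

@[simp]
theorem stateSel_mul_mul (Z : Matrix (Fin n ⊕ Fin p) (Fin n ⊕ Fin p) ℝ) :
    stateSel n p * Z * (stateSel n p)ᵀ = Z.toBlocks₁₁ := by
  conv_lhs => rw [← Matrix.fromBlocks_toBlocks Z]
  simp [stateSel, Matrix.transpose_fromCols, Matrix.fromCols_mul_fromBlocks,
    Matrix.fromCols_mul_fromRows]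

theorem blockCov_last (Z : BlockSeq n p N) : blockCov d N Z (Fin.last N) = d.covN := by
  simp [blockCov]

theorem blockCov_castSucc (Z : BlockSeq n p N) (k : Fin N) :
    blockCov d N Z k.castSucc = (Z k).toBlocks₁₁ := by
  simp [blockCov]

/-- `balance` has to be linear, so the terminal covariance, which is data and not part of a stage
block, is moved to the target. -/
theorem balance_eq_iff (Z : BlockSeq n p N) :
    balance d N Z = balanceTarget d N ↔ blockCov d N Z 0 = d.cov0 ∧
      ∀ k : Fin N, blockCov d N Z k.succ =
        dyn d k * Z k * (dyn d k)ᵀ + d.D k * (d.D k)ᵀ := by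
  have hcov : ∀ j, ∑ k : Fin N, (if j = k.castSucc then (1 : ℝ) else 0) • (Z k).toBlocks₁₁ =
      blockCov d N Z j - (if j = Fin.last N then d.covN else 0) := by
    intro j
    refine Fin.lastCases ?_ (fun i => ?_) j
    · simp [blockCov_last, (Fin.castSucc_ne_last _).symm]
    · simp [blockCov_castSucc, Fin.castSucc_ne_last]
  have hbal : ∀ j, balance d N Z j = blockCov d N Z j - (if j = Fin.last N then d.covN else 0) -
      ∑ k : Fin N, (if j = k.succ then (1 : ℝ) else 0) • (dyn d k * Z k * (dyn d k)ᵀ) := by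
    intro j
    rw [← hcov, ← Finset.sum_sub_distrib]
    simp [balance]
  have hj : ∀ j, balance d N Z j = balanceTarget d N j ↔ blockCov d N Z j =
      (if j = 0 then d.cov0 else 0) + ∑ k : Fin N, (if j = k.succ then (1 : ℝ) else 0) •
        (dyn d k * Z k * (dyn d k)ᵀ + d.D k * (d.D k)ᵀ) := by
    intro j
    simp only [hbal, balanceTarget, smul_add, Finset.sum_add_distrib]
    rw [sub_right_comm, sub_left_inj, sub_eq_iff_eq_add]
    constructor <;> intro h <;> rw [h] <;> abel
  rw [funext_iff, Fin.forall_fin_succ]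
  refine and_congr ?_ (forall_congr' fun k => ?_)
  · rw [hj]
    simp [(Fin.succ_ne_zero _).symm]
  · rw [hj]
    simp [Fin.succ_ne_zero, Finset.sum_add_distrib]

theorem mem_blockFeasible_iff (Z : BlockSeq n p N) :
    Z ∈ blockFeasible d N ↔ (∀ k, (Z k).PosSemidef) ∧ balance d N Z = balanceTarget d N := by
  rw [balance_eq_iff]
  rfl

/-- The coefficient of the stage variable `k` in the Lagrangian. -/
def dualBlock (d : SystemData n p q) (μ : ℝ) (Λ : Fin (N + 1) → Matrix (Fin n) (Fin n) ℝ)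
    (k : Fin N) : Matrix (Fin n ⊕ Fin p) (Fin n ⊕ Fin p) ℝ :=
  μ • stageWeight d k + (stateSel n p)ᵀ * Λ k.castSucc * stateSel n p -
    (dyn d k)ᵀ * Λ k.succ * dyn d k

theorem lagrangian_eq (μ : ℝ) (Λ : Fin (N + 1) → Matrix (Fin n) (Fin n) ℝ) (Z : BlockSeq n p N) :
    μ * blockCost d N Z + ∑ j, (Λ j * balance d N Z j).trace =
      ∑ k, (dualBlock d μ Λ k * Z k).trace := by
  have hcyc : ∀ (F : Matrix (Fin n) (Fin n ⊕ Fin p) ℝ) (X : Matrix (Fin n) (Fin n) ℝ)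
      (k : Fin N), (X * (F * Z k * Fᵀ)).trace = (Fᵀ * X * F * Z k).trace := by
    intro F X k
    rw [← Matrix.mul_assoc, Matrix.trace_mul_comm]
    simp only [Matrix.mul_assoc]
  have h1 : ∑ j, (Λ j * balance d N Z j).trace = ∑ k : Fin N,
      ((Λ k.castSucc * (stateSel n p * Z k * (stateSel n p)ᵀ)).trace -
        (Λ k.succ * (dyn d k * Z k * (dyn d k)ᵀ)).trace) := by
    simp only [balance, LinearMap.coe_mk, AddHom.coe_mk, Matrix.mul_sum, Matrix.trace_sum,
      Matrix.mul_sub, Matrix.trace_sub, Matrix.mul_smul, Matrix.trace_smul]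
    rw [Finset.sum_comm]
    refine Finset.sum_congr rfl fun k _ => ?_
    simp
  rw [h1, blockCost, LinearMap.coe_mk, AddHom.coe_mk, Finset.mul_sum, ← Finset.sum_add_distrib]
  refine Finset.sum_congr rfl fun k _ => ?_
  rw [hcyc, hcyc, dualBlock]
  simp only [Matrix.sub_mul, Matrix.add_mul, Matrix.smul_mul, Matrix.trace_sub, Matrix.trace_add,
    Matrix.trace_smul, smul_eq_mul]
  ring

theorem transpose_of_posSemidef {m : Type*} {Z : Matrix m m ℝ} (hZ : Z.PosSemidef) : Zᵀ = Z := by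
  simpa [Matrix.IsHermitian, Matrix.conjTranspose_eq_transpose_of_trivial] using hZ.isHermitian

theorem balance_transpose {Z : BlockSeq n p N} (hZ : ∀ k, (Z k)ᵀ = Z k) (j : Fin (N + 1)) :
    (balance d N Z j)ᵀ = balance d N Z j := by
  simp only [balance, LinearMap.coe_mk, AddHom.coe_mk, Matrix.transpose_sum, Matrix.transpose_sub,
    Matrix.transpose_smul, Matrix.transpose_mul, Matrix.transpose_transpose, hZ, Matrix.mul_assoc]

/-- The Lagrangian is a sum of trace pairings over the stages. Nonnegativity on the face makes every
compressed dual block positive semidefinite; its vanishing at an optimum makes each pairing vanish,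
and two semidefinite matrices with zero trace pairing have zero product. When `μ = 0` the cost
disappears and the same argument applies to all feasible points. -/
theorem exists_dualBlock (hQ : ∀ k < N, (d.Q k)ᵀ = d.Q k) (hR : ∀ k < N, (d.R k)ᵀ = d.R k)
    (P : BlockSeq n p N) (hPt : ∀ k, (P k)ᵀ = P k)
    (hPP : ∀ k, P k * P k = P k) (hP : ∀ Z ∈ blockFeasible d N, ∀ k, P k * Z k * P k = Z k)
    (Z₀ : BlockSeq n p N) (hZ₀ : IsOptimal (blockFeasible d N) (blockCost d N) Z₀) :
    ∃ (μ : ℝ) (Λ : Fin (N + 1) → Matrix (Fin n) (Fin n) ℝ), 0 ≤ μ ∧ (∀ j, (Λ j)ᵀ = Λ j) ∧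
      (∀ Z ∈ blockFeasible d N, (μ = 0 ∨ blockCost d N Z ≤ blockCost d N Z₀) →
        ∀ k, P k * dualBlock d μ Λ k * Z k = 0) ∧
      (μ = 0 → ∃ k, P k * dualBlock d μ Λ k * P k ≠ 0) := by
  obtain ⟨μ, l, hμ, hface, hzero, hpos⟩ := exists_face_multiplier (balance d N) (blockCost d N)
    (balanceTarget d N) P hPt (fun Z h1 h2 => hP Z ((mem_blockFeasible_iff Z).mpr ⟨h1, h2⟩)) Z₀
    hZ₀.1.1 ((mem_blockFeasible_iff Z₀).mp hZ₀.1).2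
    (fun Z h1 h2 => hZ₀.2 ((mem_blockFeasible_iff Z).mpr ⟨h1, h2⟩))
  obtain ⟨Λ, hΛ, hl⟩ := exists_trace_representation l
  have hlag : ∀ Z : BlockSeq n p N, (∀ k, (Z k)ᵀ = Z k) →
      μ * blockCost d N Z + l (balance d N Z) = ∑ k, (dualBlock d μ Λ k * Z k).trace := by
    intro Z hZ
    rw [hl _ (balance_transpose hZ), lagrangian_eq]
  have hcyc : ∀ (Z : BlockSeq n p N) (k : Fin N),
      (dualBlock d μ Λ k * (P k * Z k * P k)).trace =
        (P k * dualBlock d μ Λ k * P k * Z k).trace := by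
    intro Z k
    rw [← Matrix.mul_assoc, Matrix.trace_mul_comm]
    simp only [Matrix.mul_assoc]
  have hPZP : ∀ Z : BlockSeq n p N, (∀ k, (Z k)ᵀ = Z k) →
      ∀ k, (P k * Z k * P k)ᵀ = P k * Z k * P k := by
    intro Z hZ k
    simp [hPt, hZ, Matrix.mul_assoc]
  have hMt : ∀ k : Fin N, (dualBlock d μ Λ k)ᵀ = dualBlock d μ Λ k := by
    intro k
    simp [dualBlock, stageWeight, Matrix.fromBlocks_transpose, hQ k k.2, hR k k.2, hΛ,
      Matrix.mul_assoc]
  have hpsd : ∀ k, (P k * dualBlock d μ Λ k * P k).PosSemidef := by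
    intro k
    refine Matrix.PosSemidef.of_dotProduct_mulVec_nonneg ?_ fun x => ?_
    · rw [Matrix.IsHermitian, Matrix.conjTranspose_eq_transpose_of_trivial]
      simp [hPt, hMt, Matrix.mul_assoc]
    -- A rank-one block at stage `k` alone isolates the quadratic form of that stage.
    · let Z : BlockSeq n p N := Pi.single k (Matrix.vecMulVec x x)
      have hZ : ∀ i, (Z i).PosSemidef := by
        intro i
        rcases eq_or_ne i k with rfl | hi
        · simpa [Z] using Matrix.posSemidef_vecMulVec_self_star x
        · simpa [Z, hi] using Matrix.PosSemidef.zero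
      have h := hface Z hZ
      rw [hlag _ (hPZP Z fun i => transpose_of_posSemidef (hZ i)), Finset.sum_eq_single k] at h
      · rw [hcyc] at h
        simpa [Z, Matrix.mul_vecMulVec, Matrix.trace_vecMulVec, dotProduct_comm] using h
      · intro i _ hi
        simp [Z, hi]
      · simp
  refine ⟨μ, Λ, hμ, hΛ, ?_, ?_⟩
  · intro Z hZ hor k
    have hZf := (mem_blockFeasible_iff Z).mp hZ
    have h := hzero Z hZf.1 hZf.2 hor
    rw [hlag _ fun i => transpose_of_posSemidef (hZf.1 i)] at h
    have hterm : ∀ i, (dualBlock d μ Λ i * Z i).trace =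
        (P i * dualBlock d μ Λ i * P i * Z i).trace := by
      intro i
      rw [← hcyc, hP Z hZ i]
    simp only [hterm] at h
    rw [Finset.sum_eq_zero_iff_of_nonneg fun i _ => trace_mul_nonneg (hpsd i) (hZf.1 i)] at h
    have h2 := mul_eq_zero_of_trace_mul_eq_zero (hpsd k) (hZf.1 k) (h k (Finset.mem_univ k))
    have h3 : P k * Z k = Z k := by
      conv_lhs => rw [← hP Z hZ k]
      rw [← Matrix.mul_assoc, ← Matrix.mul_assoc, hPP, hP Z hZ k]
    rwa [Matrix.mul_assoc, h3] at h2
  · intro h0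
    subst h0
    by_contra! hall
    have h := hpos rfl
    have h1 := hlag (fun k => P k * P k) (by simp [hPt])
    rw [zero_mul, zero_add] at h1
    rw [h1] at h
    refine h.ne' (Finset.sum_eq_zero fun k _ => ?_)
    have h2 := hcyc (fun _ => 1) k
    simp only [mul_one] at h2
    rw [h2, hall k, Matrix.trace_zero]

end Blocks

/-! ### Facial reduction and the range of optimal blocks -/

section Faces

variable {n p q : ℕ} (d : SystemData n p q) (N : ℕ)

/-- Directions in which the controlled part of the next state vanishes for every feasible point. -/
def noiseFree (k : Fin N) : Submodule ℝ (Fin n → ℝ) where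
  carrier := {w | ∀ Z ∈ blockFeasible d N, Z k *ᵥ ((dyn d k)ᵀ *ᵥ w) = 0}
  add_mem' := by
    intro a b ha hb Z hZ
    rw [Matrix.mulVec_add, Matrix.mulVec_add, ha Z hZ, hb Z hZ, add_zero]
  zero_mem' := by
    intro Z _
    simp
  smul_mem' := by
    intro t a ha Z hZ
    rw [Matrix.mulVec_smul, Matrix.mulVec_smul, ha Z hZ, smul_zero]

variable {d N}

theorem dyn_transpose_mulVec (k : ℕ) (w : Fin n → ℝ) :
    (dyn d k)ᵀ *ᵥ w = Sum.elim ((d.A k)ᵀ *ᵥ w) ((d.B k)ᵀ *ᵥ w) := by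
  rw [dyn, Matrix.transpose_fromCols, Matrix.fromRows_mulVec]

theorem dualBlock_mulVec (μ : ℝ) (Λ : Fin (N + 1) → Matrix (Fin n) (Fin n) ℝ) (k : Fin N)
    (x : Fin n → ℝ) (u : Fin p → ℝ) :
    dualBlock d μ Λ k *ᵥ Sum.elim x u =
      Sum.elim (μ • (d.Q k *ᵥ x) + Λ k.castSucc *ᵥ x) (μ • (d.R k *ᵥ u)) -
        (dyn d k)ᵀ *ᵥ (Λ k.succ *ᵥ (dyn d k *ᵥ Sum.elim x u)) := by
  have h1 : ((stateSel n p)ᵀ * Λ k.castSucc * stateSel n p) *ᵥ Sum.elim x u =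
      Sum.elim (Λ k.castSucc *ᵥ x) 0 := by
    simp [stateSel, Matrix.transpose_fromCols]
  have h2 : stageWeight d k *ᵥ Sum.elim x u = Sum.elim (d.Q k *ᵥ x) (d.R k *ᵥ u) := by
    simp [stageWeight, Matrix.fromBlocks_mulVec]
  rw [dualBlock, Matrix.sub_mulVec, Matrix.add_mulVec, Matrix.smul_mulVec, h1, h2]
  congr 1
  · ext (i | i) <;> simp
  · simp only [Matrix.mulVec_mulVec, Matrix.mul_assoc]

/-- `𝒦 k` comes from complementary slackness, `P k * dualBlock d μ Λ k * Z k = 0`. On a vector `(0,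
v)` this says `Aᵀ ω = 0` and `Bᵀ ω = μ R v` for some `ω`, so `ω = 0` and then `v = 0`. On a vector
killed by `dyn d k` the `Λ k.succ` term drops out and the input component reads `μ R u = Bᵀ w` with
`w` noise-free. -/
theorem exists_optimal_face (hA : ∀ k < N, IsUnit (d.A k)) (hQ : ∀ k < N, (d.Q k).PosSemidef)
    (hR : ∀ k < N, (d.R k).PosDef) (Z₁ : BlockSeq n p N) (hZ₁ : Z₁ ∈ blockFeasible d N)
    (hpos : ∀ k, (Z₁ k).toBlocks₁₁.PosDef)
    (Z₀ : BlockSeq n p N) (hZ₀ : IsOptimal (blockFeasible d N) (blockCost d N) Z₀) :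
    ∃ 𝒦 : Fin N → Submodule ℝ (Fin n ⊕ Fin p → ℝ),
      (∀ Z, IsOptimal (blockFeasible d N) (blockCost d N) Z → ∀ k ξ, Z k *ᵥ ξ ∈ 𝒦 k) ∧
      (∀ k v, Sum.elim (0 : Fin n → ℝ) v ∈ 𝒦 k → v = 0) ∧
      (∀ k, ∀ ξ ∈ 𝒦 k, dyn d k *ᵥ ξ = 0 →
        ∃ w ∈ noiseFree d N k, d.R k *ᵥ (ξ ∘ Sum.inr) = (d.B k)ᵀ *ᵥ w) := by
  have hproj := fun k : Fin N =>
    exists_projection_matrix ((noiseFree d N k).map (dyn d k)ᵀ.mulVecLin)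
  choose P hPt hPP hker using hproj
  have hPZ : ∀ Z ∈ blockFeasible d N, ∀ k, P k * Z k = Z k := by
    intro Z hZ k
    -- The columns of `1 - P k` lie in the kernel of `P k`, the image of the noise-free directions,
    -- which every feasible block annihilates.
    have h1 : Z k * (1 - P k) = 0 := by
      refine Matrix.ext_of_mulVec_single fun i => ?_
      have h2 : (P k) *ᵥ ((1 - P k) *ᵥ Pi.single i 1) = 0 := by
        rw [Matrix.mulVec_mulVec, mul_sub, hPP, mul_one, sub_self, Matrix.zero_mulVec]
      obtain ⟨w, hw, hw'⟩ := (hker k _).mp h2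
      rw [Matrix.mulVecLin_apply] at hw'
      rw [← Matrix.mulVec_mulVec, ← hw', hw Z hZ, Matrix.zero_mulVec]
    have h2 := congrArg Matrix.transpose h1
    rw [Matrix.transpose_mul, Matrix.transpose_sub, Matrix.transpose_one, hPt,
      transpose_of_posSemidef (hZ.1 k), Matrix.transpose_zero, sub_mul, one_mul, sub_eq_zero] at h2
    exact h2.symm
  have hZP : ∀ Z ∈ blockFeasible d N, ∀ k, Z k * P k = Z k := by
    intro Z hZ k
    have h2 := congrArg Matrix.transpose (hPZ Z hZ k)
    rwa [Matrix.transpose_mul, hPt, transpose_of_posSemidef (hZ.1 k)] at h2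
  obtain ⟨μ, Λ, hμ, hΛ, hopt, hne⟩ := exists_dualBlock
    (fun k hk => transpose_of_posSemidef (hQ k hk))
    (fun k hk => transpose_of_posSemidef (hR k hk).posSemidef) P hPt hPP
    (fun Z hZ k => by rw [hPZ Z hZ, hZP Z hZ]) Z₀ hZ₀
  have hMt : ∀ k : Fin N, (dualBlock d μ Λ k)ᵀ = dualBlock d μ Λ k := by
    intro k
    simp [dualBlock, stageWeight, Matrix.fromBlocks_transpose,
      transpose_of_posSemidef (hQ k k.2), transpose_of_posSemidef (hR k k.2).posSemidef, hΛ,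
      Matrix.mul_assoc]
  -- If `μ = 0`, every compressed dual block is shown to vanish, contradicting the nondegeneracy of
  -- the multiplier.
  have hμ' : μ ≠ 0 := by
    rintro rfl
    obtain ⟨k, hk⟩ := hne rfl
    have hzero := fun Z hZ => hopt Z hZ (Or.inl rfl) k
    refine hk (Matrix.ext_of_mulVec_single fun i => ?_)
    rw [Matrix.zero_mulVec]
    set M := dualBlock d 0 Λ k
    set ξ' : Fin n ⊕ Fin p → ℝ := Pi.single i 1
    set ξ := P k *ᵥ ξ' with hξ
    -- Since the state block of `Z₁ k` is invertible, its range contains a vector `η` with the same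
    -- state part as `ξ`. The dual block sends `η` into the kernel of `P k`, so only the pure input
    -- vector `ξ - η` matters.
    let a := (Z₁ k).toBlocks₁₁⁻¹ *ᵥ (ξ ∘ Sum.inl)
    let η := Z₁ k *ᵥ Sum.elim a 0
    have hη : η ∘ Sum.inl = ξ ∘ Sum.inl := by
      have h1 : η = Sum.elim ((Z₁ k).toBlocks₁₁ *ᵥ a) ((Z₁ k).toBlocks₂₁ *ᵥ a) := by
        simp only [η]
        conv_lhs => rw [← Matrix.fromBlocks_toBlocks (Z₁ k)]
        simp [Matrix.fromBlocks_mulVec]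
      rw [h1, Sum.elim_comp_inl]
      simp only [a, Matrix.mulVec_mulVec]
      rw [Matrix.mul_nonsing_inv _ ((Matrix.isUnit_iff_isUnit_det _).mp (hpos k).isUnit),
        Matrix.one_mulVec]
    have hMη : P k *ᵥ (M *ᵥ η) = 0 := by
      rw [Matrix.mulVec_mulVec, Matrix.mulVec_mulVec, hzero Z₁ hZ₁, Matrix.zero_mulVec]
    have hdiff : ξ - η = Sum.elim (0 : Fin n → ℝ) ((ξ - η) ∘ Sum.inr) := by
      rw [← Sum.elim_comp_inl_inr (ξ - η)]
      congr 1
      ext j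
      have := congrFun hη j
      simp only [Function.comp_apply, Pi.sub_apply, Pi.zero_apply] at this ⊢
      rw [this, sub_self]
    -- With `μ = 0` and zero state part, only the dynamics term of the dual block survives.
    obtain ⟨w₀, hw₀⟩ : ∃ w₀, M *ᵥ (ξ - η) = (dyn d k)ᵀ *ᵥ w₀ := by
      refine ⟨-(Λ k.succ *ᵥ (dyn d k *ᵥ (ξ - η))), ?_⟩
      rw [hdiff, dualBlock_mulVec, Matrix.mulVec_neg]
      simp
    have hg : (P k * M * P k) *ᵥ ξ' = P k *ᵥ ((dyn d k)ᵀ *ᵥ w₀) := by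
      rw [← hw₀, Matrix.mulVec_sub, Matrix.mulVec_sub, hMη, sub_zero, hξ]
      simp only [Matrix.mulVec_mulVec, Matrix.mul_assoc]
    set g := (P k * M * P k) *ᵥ ξ' with hgdef
    have hPg : P k *ᵥ g = g := by
      rw [hgdef, Matrix.mulVec_mulVec, ← Matrix.mul_assoc, ← Matrix.mul_assoc, hPP]
    obtain ⟨w₁, -, hw₁⟩ := (hker k ((dyn d k)ᵀ *ᵥ w₀ - g)).mp (by
      rw [Matrix.mulVec_sub, hPg, ← hg, sub_self])
    rw [Matrix.mulVecLin_apply] at hw₁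
    have hg2 : (dyn d k)ᵀ *ᵥ (w₀ - w₁) = g := by
      rw [Matrix.mulVec_sub, hw₁, sub_sub_cancel]
    -- Every feasible block kills `g`, so `g` is the image of a noise-free direction and lies in the
    -- kernel of `P k`; being fixed by `P k`, it is zero.
    have hmem : w₀ - w₁ ∈ noiseFree d N k := by
      intro Z hZ
      have h1 := congrArg Matrix.transpose (hzero Z hZ)
      rw [Matrix.transpose_mul, Matrix.transpose_mul, hPt, hMt,
        transpose_of_posSemidef (hZ.1 k), Matrix.transpose_zero] at h1
      rw [hg2, hgdef, Matrix.mulVec_mulVec, ← Matrix.mul_assoc, ← Matrix.mul_assoc, hZP Z hZ]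
      have h2 : Z k * M * P k = Z k * (M * P k) := Matrix.mul_assoc _ _ _
      rw [h2, h1, Matrix.zero_mulVec]
    rw [← hPg]
    exact (hker k g).mpr ⟨_, hmem, hg2⟩
  refine ⟨fun k => LinearMap.ker (P k * dualBlock d μ Λ k).mulVecLin ⊓
    LinearMap.ker (P k - 1).mulVecLin, ?_, ?_, ?_⟩
  · intro Z hZ k ξ
    refine Submodule.mem_inf.mpr ⟨?_, ?_⟩
    · rw [LinearMap.mem_ker, Matrix.mulVecLin_apply, Matrix.mulVec_mulVec,
        hopt Z hZ.1 (Or.inr (hZ.2 hZ₀.1)) k, Matrix.zero_mulVec]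
    · rw [LinearMap.mem_ker, Matrix.mulVecLin_apply, Matrix.mulVec_mulVec, sub_mul, one_mul,
        hPZ Z hZ.1, sub_self, Matrix.zero_mulVec]
  · intro k v hv
    replace hv := (Submodule.mem_inf.mp hv).1
    rw [LinearMap.mem_ker, Matrix.mulVecLin_apply, ← Matrix.mulVec_mulVec] at hv
    obtain ⟨w, -, hw⟩ := (hker k _).mp hv
    rw [Matrix.mulVecLin_apply, dualBlock_mulVec, eq_sub_iff_add_eq, ← Matrix.mulVec_add,
      dyn_transpose_mulVec] at hw
    set ω := w + Λ k.succ *ᵥ (dyn d k *ᵥ Sum.elim 0 v)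
    have h1 : (d.A k)ᵀ *ᵥ ω = 0 := by
      have := congrArg (· ∘ Sum.inl) hw
      simpa using this
    have h2 : (d.B k)ᵀ *ᵥ ω = μ • (d.R k *ᵥ v) := by
      have := congrArg (· ∘ Sum.inr) hw
      simpa using this
    have hω : ω = 0 := by
      have hu : IsUnit (d.A k)ᵀ := (Matrix.isUnit_transpose _).mpr (hA k k.2)
      exact Matrix.mulVec_injective_of_isUnit hu (by rw [h1, Matrix.mulVec_zero])
    rw [hω, Matrix.mulVec_zero, eq_comm, smul_eq_zero_iff_right hμ'] at h2
    exact Matrix.mulVec_injective_of_isUnit (hR k k.2).isUnit (by rw [h2, Matrix.mulVec_zero])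
  · intro k ξ hξ h0
    replace hξ := (Submodule.mem_inf.mp hξ).1
    rw [LinearMap.mem_ker, Matrix.mulVecLin_apply, ← Matrix.mulVec_mulVec] at hξ
    obtain ⟨w, hw, hw'⟩ := (hker k _).mp hξ
    refine ⟨μ⁻¹ • w, Submodule.smul_mem _ _ hw, ?_⟩
    rw [← Sum.elim_comp_inl_inr ξ] at h0
    rw [← Sum.elim_comp_inl_inr ξ, Matrix.mulVecLin_apply, dualBlock_mulVec, h0,
      Matrix.mulVec_zero, Matrix.mulVec_zero, sub_zero, dyn_transpose_mulVec] at hw'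
    have h2 := congrArg (· ∘ Sum.inr) hw'
    simp only [Sum.elim_comp_inr] at h2
    rw [Matrix.mulVec_smul, h2, smul_smul, inv_mul_cancel₀ hμ', one_smul]

end Faces

/-! ### Uniqueness, positivity and zero gap of optimal blocks -/

section OptimalBlocks

variable {n p q : ℕ} {d : SystemData n p q} {N : ℕ}

theorem mulVec_sumElim_toBlocks (Z : Matrix (Fin n ⊕ Fin p) (Fin n ⊕ Fin p) ℝ)
    (x : Fin n → ℝ) (u : Fin p → ℝ) :
    Z *ᵥ Sum.elim x u = Sum.elim (Z.toBlocks₁₁ *ᵥ x + Z.toBlocks₁₂ *ᵥ u)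
      (Z.toBlocks₂₁ *ᵥ x + Z.toBlocks₂₂ *ᵥ u) := by
  conv_lhs => rw [← Matrix.fromBlocks_toBlocks Z]
  simp [Matrix.fromBlocks_mulVec]

theorem toBlocks₁₂_eq {Z : Matrix (Fin n ⊕ Fin p) (Fin n ⊕ Fin p) ℝ} (hZ : Zᵀ = Z) :
    Z.toBlocks₁₂ = Z.toBlocks₂₁ᵀ := by
  ext i j
  exact congrFun (congrFun hZ (Sum.inl i)) (Sum.inr j) |>.symm

/-- Matching columns differ by a vector of `𝒦` with zero state part, hence agree: first those of the
state, then, by symmetry of the blocks, those of the input. -/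
theorem eq_of_toBlocks₁₁_eq {𝒦 : Submodule ℝ (Fin n ⊕ Fin p → ℝ)}
    (h𝒦 : ∀ v, Sum.elim (0 : Fin n → ℝ) v ∈ 𝒦 → v = 0)
    {Z Z' : Matrix (Fin n ⊕ Fin p) (Fin n ⊕ Fin p) ℝ} (hZt : Zᵀ = Z) (hZt' : Z'ᵀ = Z')
    (hZ : ∀ ξ, Z *ᵥ ξ ∈ 𝒦) (hZ' : ∀ ξ, Z' *ᵥ ξ ∈ 𝒦)
    (h : Z.toBlocks₁₁ = Z'.toBlocks₁₁) : Z = Z' := by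
  have hsub : ∀ a a' : Fin n → ℝ, ∀ b b' : Fin p → ℝ, Sum.elim a b - Sum.elim a' b' =
      Sum.elim (a - a') (b - b') := by
    intro a a' b b'
    ext (i | i) <;> rfl
  have h21 : Z.toBlocks₂₁ = Z'.toBlocks₂₁ := by
    refine Matrix.ext_of_mulVec_single fun i => ?_
    have h1 := 𝒦.sub_mem (hZ (Sum.elim (Pi.single i 1) 0)) (hZ' (Sum.elim (Pi.single i 1) 0))
    rw [mulVec_sumElim_toBlocks, mulVec_sumElim_toBlocks, hsub, h] at h1
    simp only [Matrix.mulVec_zero, add_zero, sub_self] at h1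
    exact sub_eq_zero.mp (h𝒦 _ h1)
  have h12 : Z.toBlocks₁₂ = Z'.toBlocks₁₂ := by
    rw [toBlocks₁₂_eq hZt, toBlocks₁₂_eq hZt', h21]
  have h22 : Z.toBlocks₂₂ = Z'.toBlocks₂₂ := by
    refine Matrix.ext_of_mulVec_single fun i => ?_
    have h1 := 𝒦.sub_mem (hZ (Sum.elim 0 (Pi.single i 1))) (hZ' (Sum.elim 0 (Pi.single i 1)))
    rw [mulVec_sumElim_toBlocks, mulVec_sumElim_toBlocks, hsub, h12] at h1
    simp only [Matrix.mulVec_zero, zero_add, sub_self] at h1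
    exact sub_eq_zero.mp (h𝒦 _ h1)
  rw [← Matrix.fromBlocks_toBlocks Z, ← Matrix.fromBlocks_toBlocks Z', h, h21, h12, h22]

theorem finrank_ker_transpose {m : Type*} [Fintype m] [DecidableEq m] (C : Matrix m m ℝ) :
    Module.finrank ℝ (LinearMap.ker Cᵀ.mulVecLin) = Module.finrank ℝ (LinearMap.ker C.mulVecLin) := by
  have h1 := C.mulVecLin.finrank_range_add_finrank_ker
  have h2 := Cᵀ.mulVecLin.finrank_range_add_finrank_ker
  have h3 : Module.finrank ℝ (LinearMap.range Cᵀ.mulVecLin) =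
    Module.finrank ℝ (LinearMap.range C.mulVecLin) := C.rank_transpose
  omega

/-- Positivity is propagated forward in time. The graph property of `𝒦` then gives uniqueness by the
same induction and turns `Y` into the Schur value. -/
theorem optimal_blocks (hA : ∀ k < N, IsUnit (d.A k)) (hQ : ∀ k < N, (d.Q k).PosSemidef)
    (hR : ∀ k < N, (d.R k).PosDef) (h0 : d.cov0.PosDef) (hN : d.covN.PosDef)
    (Z₁ : BlockSeq n p N) (hZ₁ : Z₁ ∈ blockFeasible d N) (hpos : ∀ k, (Z₁ k).toBlocks₁₁.PosDef)
    (Z : BlockSeq n p N) (hZ : IsOptimal (blockFeasible d N) (blockCost d N) Z) :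
    (∀ Z', IsOptimal (blockFeasible d N) (blockCost d N) Z' → Z' = Z) ∧
    (∀ k, (Z k).toBlocks₁₁.PosDef) ∧
    (∀ k, (Z k).toBlocks₂₂ = (Z k).toBlocks₂₁ * (Z k).toBlocks₁₁⁻¹ * (Z k).toBlocks₂₁ᵀ) := by
  obtain ⟨𝒦, hmem, hgraph, hker⟩ := exists_optimal_face hA hQ hR Z₁ hZ₁ hpos Z hZ
  have hZt := fun k => transpose_of_posSemidef (hZ.1.1 k)
  have hcov₁ : ∀ j, (blockCov d N Z₁ j).PosDef := by
    refine Fin.lastCases ?_ fun k => ?_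
    · rwa [blockCov_last]
    · rw [blockCov_castSucc]
      exact hpos k
  have hposdef : ∀ j, (blockCov d N Z j).PosDef := by
    refine Fin.induction ?_ fun k ih => ?_
    · rwa [hZ.1.2.1]
    · rw [blockCov_castSucc] at ih
      have hpsd1 := (hZ.1.1 k).mul_mul_conjTranspose_same (dyn d k)
      have hpsd2 := Matrix.posSemidef_self_mul_conjTranspose (d.D k)
      rw [Matrix.conjTranspose_eq_transpose_of_trivial] at hpsd1 hpsd2
      rw [hZ.1.2.2 k]
      have hpsd := hpsd1.add hpsd2
      refine Matrix.PosDef.of_dotProduct_mulVec_pos hpsd.isHermitian fun y hy => ?_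
      refine lt_of_le_of_ne (hpsd.dotProduct_mulVec_nonneg y) fun hzero => hy ?_
      rw [Matrix.add_mulVec, dotProduct_add] at hzero
      have hn1 := hpsd1.dotProduct_mulVec_nonneg y
      have hn2 := hpsd2.dotProduct_mulVec_nonneg y
      have hz1 : Z k *ᵥ ((dyn d k)ᵀ *ᵥ y) = 0 := by
        rw [← (hZ.1.1 k).dotProduct_mulVec_zero_iff]
        have h1 : star y ⬝ᵥ (dyn d k * Z k * (dyn d k)ᵀ) *ᵥ y = 0 := by linarith
        rw [Matrix.dotProduct_mulVec, Matrix.mulVec_transpose] at *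
        simp only [star_trivial, ← Matrix.vecMul_vecMul, ← Matrix.dotProduct_mulVec,
          Matrix.mulVec_transpose] at h1 ⊢
        exact h1
      have hz2 : (d.D k * (d.D k)ᵀ) *ᵥ y = 0 := by
        rw [← hpsd2.dotProduct_mulVec_zero_iff]
        linarith
      -- This is the closed-loop matrix `A + B K` with `K = U S⁻¹`, available because the induction
      -- hypothesis makes `S` invertible.
      let C : Matrix (Fin n) (Fin n) ℝ :=
        dyn d k * Z k * Matrix.fromRows (Z k).toBlocks₁₁⁻¹ (0 : Matrix (Fin p) (Fin n) ℝ)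
      have hCt : ∀ w, Z k *ᵥ ((dyn d k)ᵀ *ᵥ w) = 0 → Cᵀ *ᵥ w = 0 := by
        intro w hw
        simp only [C, Matrix.transpose_mul, hZt, ← Matrix.mulVec_mulVec, hw, Matrix.mulVec_zero]
      -- If `(A + B K) x = 0`, the optimal face gives `K x = R⁻¹ Bᵀ w` with `w` noise-free, so `x =
      -- -A⁻¹ B R⁻¹ Bᵀ w`.
      have hkerC : LinearMap.ker C.mulVecLin ≤ (noiseFree d N k).map
          (-((d.A k)⁻¹ * d.B k * (d.R k)⁻¹ * (d.B k)ᵀ)).mulVecLin := by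
        intro x hx
        rw [LinearMap.mem_ker, Matrix.mulVecLin_apply] at hx
        set ξ := Z k *ᵥ Sum.elim ((Z k).toBlocks₁₁⁻¹ *ᵥ x) 0 with hξ
        have hF : dyn d k *ᵥ ξ = 0 := by
          rw [← hx]
          simp only [C, ← Matrix.mulVec_mulVec, Matrix.fromRows_mulVec, Matrix.zero_mulVec, hξ]
        obtain ⟨w, hw, hRw⟩ := hker k ξ (hmem Z hZ k _) hF
        have hξx : ξ ∘ Sum.inl = x := by
          rw [hξ, mulVec_sumElim_toBlocks, Sum.elim_comp_inl, Matrix.mulVec_zero, add_zero,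
            Matrix.mulVec_mulVec, Matrix.mul_nonsing_inv _
            ((Matrix.isUnit_iff_isUnit_det _).mp ih.isUnit), Matrix.one_mulVec]
        rw [dyn, Matrix.fromCols_mulVec, hξx] at hF
        have hAx : d.A k *ᵥ x = -(d.B k *ᵥ (ξ ∘ Sum.inr)) := eq_neg_of_add_eq_zero_left hF
        have hu : ξ ∘ Sum.inr = (d.R k)⁻¹ *ᵥ ((d.B k)ᵀ *ᵥ w) := by
          rw [← hRw, Matrix.mulVec_mulVec, Matrix.nonsing_inv_mul _
            ((Matrix.isUnit_iff_isUnit_det _).mp (hR k k.2).isUnit), Matrix.one_mulVec]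
        refine ⟨w, hw, ?_⟩
        have hx' : x = (d.A k)⁻¹ *ᵥ (d.A k *ᵥ x) := by
          rw [Matrix.mulVec_mulVec, Matrix.nonsing_inv_mul _
            ((Matrix.isUnit_iff_isUnit_det _).mp (hA k k.2)), Matrix.one_mulVec]
        rw [hx', hAx, hu, Matrix.mulVecLin_apply, Matrix.neg_mulVec, Matrix.mulVec_neg]
        simp only [Matrix.mulVec_mulVec, Matrix.mul_assoc]
      have hle : noiseFree d N k ≤ LinearMap.ker Cᵀ.mulVecLin := by
        intro w hw
        rw [LinearMap.mem_ker, Matrix.mulVecLin_apply]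
        exact hCt w (hw Z hZ.1)
      -- The noise-free space lies in `ker Cᵀ`, while `dim ker Cᵀ = dim ker C` is at most its
      -- dimension by `hkerC`; so the two coincide.
      have heq := Submodule.eq_of_le_of_finrank_le hle (by
        rw [finrank_ker_transpose]
        exact (Submodule.finrank_mono hkerC).trans (Submodule.finrank_map_le _ _))
      have hy𝒲 : y ∈ noiseFree d N k := by
        rw [heq, LinearMap.mem_ker, Matrix.mulVecLin_apply]
        exact hCt y hz1
      refine Matrix.mulVec_injective_of_isUnit (hcov₁ k.succ).isUnit ?_
      rw [Matrix.mulVec_zero, hZ₁.2.2 k, Matrix.add_mulVec, hz2, add_zero]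
      simp only [← Matrix.mulVec_mulVec]
      rw [hy𝒲 Z₁ hZ₁, Matrix.mulVec_zero]
  have hposdef' : ∀ k, (Z k).toBlocks₁₁.PosDef := by
    intro k
    rw [← blockCov_castSucc (d := d)]
    exact hposdef _
  refine ⟨?_, hposdef', ?_⟩
  · intro Z' hZ'
    have hstep : ∀ k : Fin N, blockCov d N Z' k.castSucc = blockCov d N Z k.castSucc →
        Z' k = Z k := by
      intro k hk
      rw [blockCov_castSucc, blockCov_castSucc] at hk
      exact eq_of_toBlocks₁₁_eq (hgraph k) (transpose_of_posSemidef (hZ'.1.1 k)) (hZt k)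
        (hmem Z' hZ' k) (hmem Z hZ k) hk
    have hcov : ∀ j, blockCov d N Z' j = blockCov d N Z j := by
      refine Fin.induction ?_ fun k ih => ?_
      · rw [hZ'.1.2.1, hZ.1.2.1]
      · rw [hZ'.1.2.2 k, hZ.1.2.2 k, hstep k ih]
    exact funext fun k => hstep k (hcov _)
  · intro k
    refine Matrix.ext_of_mulVec_single fun i => ?_
    -- The state component is chosen to cancel the state part of the image, leaving the Schur
    -- complement applied to a basis vector as input part.
    have h1 := hmem Z hZ k (Sum.elim
      (-((Z k).toBlocks₁₁⁻¹ *ᵥ ((Z k).toBlocks₁₂ *ᵥ Pi.single i 1))) (Pi.single i 1))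
    rw [mulVec_sumElim_toBlocks, Matrix.mulVec_neg, Matrix.mulVec_mulVec, Matrix.mul_nonsing_inv _
      ((Matrix.isUnit_iff_isUnit_det _).mp (hposdef' k).isUnit), Matrix.one_mulVec,
      neg_add_cancel] at h1
    have h2 := hgraph k _ h1
    rw [Matrix.mulVec_neg, neg_add_eq_zero] at h2
    rw [← h2, toBlocks₁₂_eq (hZt k)]
    simp only [Matrix.mulVec_mulVec, Matrix.mul_assoc]

end OptimalBlocks

/-! ### Existence of an optimal block sequence -/

section Existence

/-- Testing on `e i ± e j` bounds twice the entry by the sum of the two diagonal entries. -/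
theorem abs_apply_le_trace {m : Type*} [Fintype m] {Z : Matrix m m ℝ}
    (hZ : Z.PosSemidef) (i j : m) : |Z i j| ≤ Z.trace := by
  classical
  have hdiag : ∀ i, Z i i ≤ Z.trace := fun i =>
    Finset.single_le_sum (f := fun i => Z i i) (fun i _ => hZ.diag_nonneg) (Finset.mem_univ i)
  have hsymm : Z j i = Z i j := congrFun (congrFun (transpose_of_posSemidef hZ) i) j
  have h1 := hZ.dotProduct_mulVec_nonneg (Pi.single i 1 + Pi.single j 1)
  have h2 := hZ.dotProduct_mulVec_nonneg (Pi.single i 1 - Pi.single j 1)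
  simp [Matrix.mulVec_add, Matrix.mulVec_sub, add_dotProduct, sub_dotProduct, dotProduct_add,
    dotProduct_sub, hsymm] at h1 h2
  have := hdiag i
  have := hdiag j
  rw [abs_le]
  constructor <;> linarith

/-- By openness, `R - r • 1` is still positive definite for small `r > 0`; pair it with `Y`. -/
theorem exists_pos_mul_trace_le {m : Type*} [Fintype m] {R : Matrix m m ℝ}
    (hR : R.PosDef) : ∃ r : ℝ, 0 < r ∧ ∀ Y : Matrix m m ℝ, Y.PosSemidef →
      r * Y.trace ≤ (R * Y).trace := by
  classical
  have hc : Continuous fun t : ℝ => R - t • (1 : Matrix m m ℝ) := by fun_prop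
  have hRt := transpose_of_posSemidef hR.posSemidef
  have hmem : {X : Matrix m m ℝ | (X + Xᵀ).PosDef} ∈ nhds (R - (0 : ℝ) • (1 : Matrix m m ℝ)) := by
    refine isOpen_posDef_add_transpose.mem_nhds ?_
    rw [Set.mem_ofPred_eq, zero_smul, sub_zero, hRt]
    exact hR.add hR
  have hev := (hc.tendsto 0).eventually hmem
  obtain ⟨r, hr, hr0⟩ := ((hev.filter_mono nhdsWithin_le_nhds).and
    (self_mem_nhdsWithin : Set.Ioi (0 : ℝ) ∈ nhdsWithin 0 (Set.Ioi 0))).exists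
  refine ⟨r, hr0, fun Y hY => ?_⟩
  have h := trace_mul_nonneg hr.posSemidef hY
  rw [Matrix.transpose_sub, hRt, Matrix.transpose_smul, Matrix.transpose_one] at h
  simp only [Matrix.add_mul, Matrix.sub_mul, Matrix.smul_mul, one_mul, Matrix.trace_add,
    Matrix.trace_sub, Matrix.trace_smul, smul_eq_mul] at h
  linarith

theorem isClosed_posSemidef {m : Type*} [Fintype m] :
    IsClosed {X : Matrix m m ℝ | X.PosSemidef} := by
  have : {X : Matrix m m ℝ | X.PosSemidef} =
      {X | Xᵀ = X} ∩ ⋂ y : m → ℝ, {X | 0 ≤ y ⬝ᵥ (X *ᵥ y)} := by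
    ext X
    simp [Matrix.posSemidef_iff_dotProduct_mulVec, Matrix.IsHermitian,
      Matrix.conjTranspose_eq_transpose_of_trivial]
  rw [this]
  refine IsClosed.inter (isClosed_eq (by fun_prop) continuous_id) (isClosed_iInter fun y => ?_)
  exact isClosed_le continuous_const (by fun_prop)

variable {n p q : ℕ} {d : SystemData n p q} {N : ℕ}

theorem trace_fromBlocks {m m' : Type*} [Fintype m] [Fintype m'] (X : Matrix m m ℝ)
    (Y : Matrix m m' ℝ) (Z : Matrix m' m ℝ) (W : Matrix m' m' ℝ) :
    (Matrix.fromBlocks X Y Z W).trace = X.trace + W.trace := by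
  simp [Matrix.trace]

theorem trace_stageWeight_mul (k : ℕ) (Z : Matrix (Fin n ⊕ Fin p) (Fin n ⊕ Fin p) ℝ) :
    (stageWeight d k * Z).trace =
      (d.Q k * Z.toBlocks₁₁).trace + (d.R k * Z.toBlocks₂₂).trace := by
  conv_lhs => rw [← Matrix.fromBlocks_toBlocks Z]
  rw [stageWeight, Matrix.fromBlocks_multiply, trace_fromBlocks]
  simp

theorem isCompact_box {m : Type*} (C : ℝ) :
    IsCompact {X : Matrix m m ℝ | ∀ i j, X i j ∈ Set.Icc (-C) C} := by
  have h := isCompact_univ_pi fun _ : m => isCompact_univ_pi fun _ : m =>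
    isCompact_Icc (a := -C) (b := C)
  have heq : {X : Matrix m m ℝ | ∀ i j, X i j ∈ Set.Icc (-C) C} =
      Set.univ.pi fun _ => Set.univ.pi fun _ => Set.Icc (-C) C := by
    ext X
    exact ⟨fun h i _ j _ => h i j, fun h i j => h i trivial j trivial⟩
  rw [heq]
  exact h

/-- A sublevel set is compact: the cost bounds every `Y k` because `R k ≻ 0`, and the covariances
are bounded forward in time from `cov0`, since `S k` and `Y k` bound the whole block by its trace.
-/
theorem exists_isOptimal_blocks (hQ : ∀ k < N, (d.Q k).PosSemidef)
    (hR : ∀ k < N, (d.R k).PosDef) (hne : (blockFeasible d N).Nonempty) :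
    ∃ Z, IsOptimal (blockFeasible d N) (blockCost d N) Z := by
  obtain ⟨Z₁, hZ₁⟩ := hne
  let K : Set (BlockSeq n p N) := {Z | Z ∈ blockFeasible d N ∧
    blockCost d N Z ≤ blockCost d N Z₁}
  have hpsd₁ : ∀ Z ∈ K, ∀ k, (Z k).toBlocks₁₁.PosSemidef := fun Z hZ k =>
    (hZ.1.1 k).submatrix Sum.inl
  have hpsd₂ : ∀ Z ∈ K, ∀ k, (Z k).toBlocks₂₂.PosSemidef := fun Z hZ k =>
    (hZ.1.1 k).submatrix Sum.inr
  have hstage : ∀ Z ∈ K, ∀ k : Fin N, (d.R k * (Z k).toBlocks₂₂).trace ≤ blockCost d N Z₁ := by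
    intro Z hZ k
    have hterm : ∀ i : Fin N, 0 ≤ (stageWeight d i * Z i).trace := by
      intro i
      rw [trace_stageWeight_mul]
      exact add_nonneg (trace_mul_nonneg (hQ i i.2) (hpsd₁ Z hZ i))
        (trace_mul_nonneg (hR i i.2).posSemidef (hpsd₂ Z hZ i))
    have h1 : (stageWeight d k * Z k).trace ≤ blockCost d N Z :=
      Finset.single_le_sum (f := fun i : Fin N => (stageWeight d i * Z i).trace)
        (fun i _ => hterm i) (Finset.mem_univ k)
    rw [trace_stageWeight_mul] at h1
    linarith [hZ.2, trace_mul_nonneg (hQ k k.2) (hpsd₁ Z hZ k)]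
  have hstep : ∀ k : Fin N, (∃ C : ℝ, ∀ Z ∈ K, (blockCov d N Z k.castSucc).trace ≤ C) →
      ∃ C : ℝ, ∀ Z ∈ K, (Z k).trace ≤ C := by
    rintro k ⟨C, hC⟩
    obtain ⟨r, hr, hrY⟩ := exists_pos_mul_trace_le (hR k k.2)
    refine ⟨C + blockCost d N Z₁ / r, fun Z hZ => ?_⟩
    have h1 := hC Z hZ
    rw [blockCov_castSucc] at h1
    have h2 : (Z k).toBlocks₂₂.trace ≤ blockCost d N Z₁ / r := by
      rw [le_div_iff₀ hr, mul_comm]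
      exact (hrY _ (hpsd₂ Z hZ k)).trans (hstage Z hZ k)
    have h3 : (Z k).trace = (Z k).toBlocks₁₁.trace + (Z k).toBlocks₂₂.trace := by
      conv_lhs => rw [← Matrix.fromBlocks_toBlocks (Z k), trace_fromBlocks]
    linarith
  have hbox : ∀ k : Fin N, ∀ C : ℝ, (∀ Z ∈ K, (Z k).trace ≤ C) → ∀ Z ∈ K,
      Z k ∈ {X : Matrix (Fin n ⊕ Fin p) (Fin n ⊕ Fin p) ℝ | ∀ i j, X i j ∈ Set.Icc (-C) C} := by
    intro k C hC Z hZ i j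
    exact abs_le.mp ((abs_apply_le_trace (hZ.1.1 k) i j).trans (hC Z hZ))
  have hcov : ∀ j, ∃ C : ℝ, ∀ Z ∈ K, (blockCov d N Z j).trace ≤ C := by
    refine Fin.induction ⟨d.cov0.trace, fun Z hZ => by rw [hZ.1.2.1]⟩ fun k ih => ?_
    obtain ⟨C, hC⟩ := hstep k ih
    have hcont : Continuous fun X : Matrix (Fin n ⊕ Fin p) (Fin n ⊕ Fin p) ℝ =>
        (dyn d k * X * (dyn d k)ᵀ + d.D k * (d.D k)ᵀ).trace := by fun_prop
    obtain ⟨C', hC'⟩ := ((isCompact_box C).image hcont).bddAbove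
    refine ⟨C', fun Z hZ => ?_⟩
    rw [hZ.1.2.2 k]
    exact hC' ⟨Z k, hbox k C hC Z hZ, rfl⟩
  choose C hC using fun k => hstep k (hcov k.castSucc)
  have hclosed : IsClosed K := by
    have hK : K = (⋂ k, (fun Z : BlockSeq n p N => Z k) ⁻¹' {X | X.PosSemidef}) ∩
        ({Z | balance d N Z = balanceTarget d N} ∩
          {Z | blockCost d N Z ≤ blockCost d N Z₁}) := by
      ext Z
      simp [K, mem_blockFeasible_iff, and_assoc]
    rw [hK]
    refine IsClosed.inter (isClosed_iInter fun k => isClosed_posSemidef.preimage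
      (continuous_apply k)) (IsClosed.inter (isClosed_eq ?_ continuous_const)
        (isClosed_le ?_ continuous_const))
    · exact (balance d N).continuous_of_finiteDimensional
    · exact (blockCost d N).continuous_of_finiteDimensional
  have hcompact : IsCompact K :=
    (isCompact_univ_pi fun k => isCompact_box (C k)).of_isClosed_subset hclosed
      fun Z hZ k _ => hbox k (C k) (hC k) Z hZ
  obtain ⟨Z, hZ, hmin⟩ := hcompact.exists_isMinOn ⟨Z₁, hZ₁, le_rfl⟩
    (blockCost d N).continuous_of_finiteDimensional.continuousOn
  refine ⟨Z, hZ.1, fun Z' hZ' => ?_⟩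
  rcases le_total (blockCost d N Z') (blockCost d N Z₁) with h | h
  · exact hmin ⟨hZ', h⟩
  · exact hZ.2.trans h

end Existence

/-! ### Transfer between the four optimization problems -/

section Transfer

variable {n p q : ℕ} {d : SystemData n p q} {N : ℕ}

/-- The stage variables `[S k, (U k)ᵀ; U k, Y k]` of a point of the relaxation. -/
def toBlockSeq (z : CovSeq n N × InputSeq n p N × SlackSeq p N) : BlockSeq n p N := fun k =>
  Matrix.fromBlocks (z.1 k.castSucc) (z.2.1 k)ᵀ (z.2.1 k) (z.2.2 k)

theorem relaxedCost_eq (z : CovSeq n N × InputSeq n p N × SlackSeq p N) :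
    relaxedCost d N z = blockCost d N (toBlockSeq z) := by
  refine Finset.sum_congr rfl fun k _ => ?_
  rw [trace_stageWeight_mul]
  rfl

theorem dyn_mul_fromBlocks_mul (k : ℕ) (S : Matrix (Fin n) (Fin n) ℝ)
    (U : Matrix (Fin p) (Fin n) ℝ) (Y : Matrix (Fin p) (Fin p) ℝ) :
    dyn d k * Matrix.fromBlocks S Uᵀ U Y * (dyn d k)ᵀ =
      d.A k * S * (d.A k)ᵀ + d.B k * U * (d.A k)ᵀ + d.A k * Uᵀ * (d.B k)ᵀ +
        d.B k * Y * (d.B k)ᵀ := by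
  rw [dyn, Matrix.transpose_fromCols, Matrix.fromCols_mul_fromBlocks, Matrix.fromCols_mul_fromRows,
    Matrix.add_mul, Matrix.add_mul]
  abel

theorem mem_sdpFeasible_iff (z : CovSeq n N × InputSeq n p N × SlackSeq p N) :
    z ∈ sdpFeasible d N ↔
      toBlockSeq z ∈ blockFeasible d N ∧ blockCov d N (toBlockSeq z) = z.1 := by
  have hcov : blockCov d N (toBlockSeq z) = z.1 ↔ z.1 (Fin.last N) = d.covN := by
    constructor
    · intro h
      rw [← h, blockCov_last]
    · intro h
      ext1 j
      refine Fin.lastCases ?_ (fun k => ?_) j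
      · rw [blockCov_last, h]
      · rw [blockCov_castSucc]
        rfl
  have hdyn : ∀ k : Fin N, d.A k * z.1 k.castSucc * (d.A k)ᵀ + d.B k * z.2.1 k * (d.A k)ᵀ
        + d.A k * (z.2.1 k)ᵀ * (d.B k)ᵀ + d.B k * z.2.2 k * (d.B k)ᵀ
        + d.D k * (d.D k)ᵀ - z.1 k.succ = 0 ↔
      z.1 k.succ = dyn d k * toBlockSeq z k * (dyn d k)ᵀ + d.D k * (d.D k)ᵀ := by
    intro k
    rw [toBlockSeq, dyn_mul_fromBlocks_mul, sub_eq_zero, eq_comm]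
  constructor
  · rintro ⟨⟨h0, hN, hk⟩, hpsd⟩
    have h := hcov.mpr hN
    refine ⟨⟨hpsd, ?_, fun k => ?_⟩, h⟩
    · rw [h, h0]
    · rw [h]
      exact (hdyn k).mp (hk k)
  · rintro ⟨⟨hpsd, h0, hk⟩, h⟩
    rw [h] at h0 hk
    exact ⟨⟨h0, hcov.mp h, fun k => (hdyn k).mpr (hk k)⟩, hpsd⟩

/-- For `S k ≻ 0` the gap constraint is the Schur complement form of the linear matrix inequality.
-/
theorem mem_relaxedFeasible_iff (z : CovSeq n N × InputSeq n p N × SlackSeq p N) :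
    z ∈ relaxedFeasible d N ↔ z ∈ sdpFeasible d N ∧ ∀ k : Fin N, (z.1 k.castSucc).PosDef := by
  have hk : ∀ k : Fin N, (z.1 k.castSucc).PosDef → ((-(gap z k)).PosSemidef ↔
      (Matrix.fromBlocks (z.1 k.castSucc) (z.2.1 k)ᵀ (z.2.1 k) (z.2.2 k)).PosSemidef) := by
    intro k hS
    have := hS.isUnit.invertible
    have h := Matrix.PosDef.fromBlocks₁₁ (z.2.1 k)ᵀ (z.2.2 k) hS
    rw [Matrix.conjTranspose_eq_transpose_of_trivial, Matrix.transpose_transpose] at h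
    rw [h, gap, neg_sub]
  constructor
  · rintro ⟨hdyn, h⟩
    exact ⟨⟨hdyn, fun k => (hk k (h k).1).mp (h k).2⟩, fun k => (h k).1⟩
  · rintro ⟨⟨hdyn, h⟩, hS⟩
    exact ⟨hdyn, fun k => ⟨hS k, (hk k (hS k)).mpr (h k)⟩⟩

/-- A point of the steering problem as a point of the relaxation with vanishing gap. -/
noncomputable def liftSteering (z : CovSeq n N × InputSeq n p N) :
    CovSeq n N × InputSeq n p N × SlackSeq p N :=
  (z.1, z.2, fun k => z.2 k * (z.1 k.castSucc)⁻¹ * (z.2 k)ᵀ)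

theorem relaxedCost_liftSteering (z : CovSeq n N × InputSeq n p N) :
    relaxedCost d N (liftSteering z) = steeringCost d N z := by
  simp only [relaxedCost, liftSteering, steeringCost, Matrix.mul_assoc]

theorem liftSteering_mem_iff (z : CovSeq n N × InputSeq n p N) :
    liftSteering z ∈ relaxedFeasible d N ↔ z ∈ steeringFeasible d N := by
  simp only [relaxedFeasible, RelaxedDynamics, liftSteering, gap, steeringFeasible,
    Set.mem_ofPred_eq, sub_self, neg_zero, Matrix.PosSemidef.zero, and_true, Matrix.mul_assoc]
  constructor
  · rintro ⟨⟨h0, hN, h⟩, hS⟩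
    exact ⟨h0, hN, fun k => ⟨hS k, h k⟩⟩
  · rintro ⟨h0, hN, h⟩
    exact ⟨⟨h0, hN, fun k => (h k).2⟩, fun k => (h k).1⟩

/-- A steering law as a point of the semidefinite program. -/
def liftLaw (z : CovSeq n N × InputSeq n p N) : CovSeq n N × InputSeq n p N × SlackSeq p N :=
  (z.1, fun k => z.2 k * z.1 k.castSucc, fun k => z.2 k * z.1 k.castSucc * (z.2 k)ᵀ)

theorem relaxedCost_liftLaw (z : CovSeq n N × InputSeq n p N) :
    relaxedCost d N (liftLaw z) = lawCost d N z := by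
  simp only [relaxedCost, liftLaw, lawCost, Matrix.mul_assoc]

theorem posSemidef_of_mem_lawFeasible (h0 : d.cov0.PosSemidef) {z : CovSeq n N × InputSeq n p N}
    (hz : z ∈ lawFeasible d N) (j : Fin (N + 1)) : (z.1 j).PosSemidef := by
  induction j using Fin.induction with
  | zero => rwa [hz.1]
  | succ k ih =>
    rw [hz.2.2 k]
    have h1 := ih.mul_mul_conjTranspose_same (d.A k + d.B k * z.2 k)
    have h2 := Matrix.posSemidef_self_mul_conjTranspose (d.D k)
    rw [Matrix.conjTranspose_eq_transpose_of_trivial] at h1 h2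
    exact h1.add h2

theorem closedLoop_eq (k : ℕ) {S : Matrix (Fin n) (Fin n) ℝ} (hS : Sᵀ = S)
    (K : Matrix (Fin p) (Fin n) ℝ) :
    (d.A k + d.B k * K) * S * (d.A k + d.B k * K)ᵀ =
      d.A k * S * (d.A k)ᵀ + d.B k * (K * S) * (d.A k)ᵀ + d.A k * (K * S)ᵀ * (d.B k)ᵀ +
        d.B k * (K * S * Kᵀ) * (d.B k)ᵀ := by
  simp only [Matrix.transpose_add, Matrix.transpose_mul, hS, Matrix.add_mul, Matrix.mul_add,
    Matrix.mul_assoc]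
  abel

/-- The lifted block factors as `[1; K] S [1; K]ᵀ`, so it is semidefinite even where `S` is
singular; this covers laws whose covariances are not assumed positive definite. -/
theorem liftLaw_mem (h0 : d.cov0.PosSemidef) {z : CovSeq n N × InputSeq n p N}
    (hz : z ∈ lawFeasible d N) : liftLaw z ∈ sdpFeasible d N := by
  have hpsd := posSemidef_of_mem_lawFeasible h0 hz
  refine ⟨⟨hz.1, hz.2.1, fun k => ?_⟩, fun k => ?_⟩
  · rw [sub_eq_zero]
    exact ((hz.2.2 k).trans (by rw [closedLoop_eq k (transpose_of_posSemidef (hpsd _))]; rfl)).symm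
  · have h := (hpsd k.castSucc).mul_mul_conjTranspose_same
      (Matrix.fromRows (1 : Matrix (Fin n) (Fin n) ℝ) (z.2 k))
    convert h using 1
    rw [Matrix.conjTranspose_eq_transpose_of_trivial, Matrix.transpose_fromRows,
      Matrix.fromRows_mul, Matrix.fromRows_mul_fromCols]
    simp [liftLaw, Matrix.transpose_mul, transpose_of_posSemidef (hpsd k.castSucc)]

theorem isOptimal_iff_eq {α : Type*} {F : Set α} {J : α → ℝ} {z₀ : α} (hF : z₀ ∈ F)
    (hle : ∀ z ∈ F, J z₀ ≤ J z) (hlt : ∀ z ∈ F, J z ≤ J z₀ → z = z₀) (z : α) :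
    IsOptimal F J z ↔ z = z₀ := by
  constructor
  · intro h
    exact hlt z h.1 (h.2 hF)
  · rintro rfl
    exact ⟨hF, hle⟩

theorem exists_optimum (hA : ∀ k < N, IsUnit (d.A k)) (hQ : ∀ k < N, (d.Q k).PosSemidef)
    (hR : ∀ k < N, (d.R k).PosDef) (h0 : d.cov0.PosDef) (hN : d.covN.PosDef)
    (hne : (relaxedFeasible d N).Nonempty) :
    ∃ z₀ ∈ relaxedFeasible d N, (∀ k, gap z₀ k = 0) ∧
      (∀ z ∈ sdpFeasible d N, relaxedCost d N z₀ ≤ relaxedCost d N z) ∧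
      (∀ z ∈ sdpFeasible d N, relaxedCost d N z ≤ relaxedCost d N z₀ → z = z₀) := by
  obtain ⟨z₁, hz₁⟩ := hne
  rw [mem_relaxedFeasible_iff, mem_sdpFeasible_iff] at hz₁
  obtain ⟨Z, hZ⟩ := exists_isOptimal_blocks hQ hR ⟨_, hz₁.1.1⟩
  obtain ⟨huniq, hpos, hgap⟩ := optimal_blocks hA hQ hR h0 hN _ hz₁.1.1 hz₁.2 Z hZ
  let z₀ : CovSeq n N × InputSeq n p N × SlackSeq p N :=
    (blockCov d N Z, fun k => (Z k).toBlocks₂₁, fun k => (Z k).toBlocks₂₂)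
  have hblock : toBlockSeq z₀ = Z := by
    ext1 k
    simp only [toBlockSeq, z₀]
    rw [blockCov_castSucc, ← toBlocks₁₂_eq (transpose_of_posSemidef (hZ.1.1 k)),
      Matrix.fromBlocks_toBlocks]
  refine ⟨z₀, ?_, ?_, ?_, ?_⟩
  · rw [mem_relaxedFeasible_iff, mem_sdpFeasible_iff, hblock]
    refine ⟨⟨hZ.1, rfl⟩, fun k => ?_⟩
    simp only [z₀]
    rw [blockCov_castSucc]
    exact hpos k
  · intro k
    simp only [gap, z₀]
    rw [blockCov_castSucc, hgap, sub_self]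
  · intro z hz
    rw [relaxedCost_eq, relaxedCost_eq, hblock]
    exact hZ.2 ((mem_sdpFeasible_iff z).mp hz).1
  · intro z hz hle
    rw [relaxedCost_eq, relaxedCost_eq, hblock] at hle
    obtain ⟨hz, hcov⟩ := (mem_sdpFeasible_iff z).mp hz
    have h := huniq _ ⟨hz, fun Z' hZ' => hle.trans (hZ.2 hZ')⟩
    refine Prod.ext ?_ (Prod.ext ?_ ?_)
    · rw [← hcov, h]
    · simp only [z₀, ← h]
      rfl
    · simp only [z₀, ← h]
      rfl

/-- Each problem maps into the semidefinite program with its cost preserved, and the unique optimum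
there is attained in each image. Minimality and uniqueness pull back; for gains, `U = K S` recovers
`K` because the optimal `S` is invertible. -/
theorem exists_common_optimum (hA : ∀ k < N, IsUnit (d.A k)) (hQ : ∀ k < N, (d.Q k).PosSemidef)
    (hR : ∀ k < N, (d.R k).PosDef) (h0 : d.cov0.PosDef) (hN : d.covN.PosDef)
    (hne : (relaxedFeasible d N).Nonempty) :
    ∃ (S : CovSeq n N) (U : InputSeq n p N) (Y : SlackSeq p N), (∀ k, gap (S, U, Y) k = 0) ∧
      (∀ z, IsOptimal (relaxedFeasible d N) (relaxedCost d N) z ↔ z = (S, U, Y)) ∧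
      (∀ z, IsOptimal (steeringFeasible d N) (steeringCost d N) z ↔ z = (S, U)) ∧
      (∀ z, IsOptimal (sdpFeasible d N) (relaxedCost d N) z ↔ z = (S, U, Y)) ∧
      (∀ z, IsOptimal (lawFeasible d N) (lawCost d N) z ↔
        z = (S, fun k => U k * (S k.castSucc)⁻¹)) := by
  obtain ⟨⟨S, U, Y⟩, hmem, hgap, hle, heq⟩ := exists_optimum hA hQ hR h0 hN hne
  obtain ⟨hsdp, hpos⟩ := (mem_relaxedFeasible_iff _).mp hmem
  have hsub : ∀ z ∈ relaxedFeasible d N, z ∈ sdpFeasible d N :=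
    fun z hz => ((mem_relaxedFeasible_iff z).mp hz).1
  have hlift : liftSteering (S, U) = (S, U, Y) :=
    Prod.ext rfl (Prod.ext rfl (funext fun k => sub_eq_zero.mp (hgap k)))
  have hdet : ∀ k : Fin N, IsUnit (S k.castSucc).det := fun k =>
    (Matrix.isUnit_iff_isUnit_det _).mp (hpos k).isUnit
  have hgain : ∀ k : Fin N, U k * (S k.castSucc)⁻¹ * S k.castSucc = U k := fun k =>
    Matrix.nonsing_inv_mul_cancel_right _ _ (hdet k)
  have hSt : ∀ k : Fin N, (S k.castSucc)ᵀ = S k.castSucc := fun k =>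
    transpose_of_posSemidef (hpos k).posSemidef
  have hliftLaw : liftLaw (S, fun k => U k * (S k.castSucc)⁻¹) = (S, U, Y) := by
    refine Prod.ext rfl (Prod.ext (funext hgain) (funext fun k => ?_))
    have h1 : U k * (S k.castSucc)⁻¹ * (U k)ᵀ = Y k := sub_eq_zero.mp (hgap k)
    simp only [liftLaw]
    rw [hgain, ← h1, Matrix.transpose_mul, Matrix.transpose_nonsing_inv, hSt, Matrix.mul_assoc]
  refine ⟨S, U, Y, hgap, isOptimal_iff_eq hmem (fun z hz => hle z (hsub z hz))
    (fun z hz => heq z (hsub z hz)), isOptimal_iff_eq ?_ ?_ ?_, isOptimal_iff_eq hsdp hle heq,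
    isOptimal_iff_eq ?_ ?_ ?_⟩
  · rwa [← liftSteering_mem_iff, hlift]
  · intro z hz
    rw [← relaxedCost_liftSteering, ← relaxedCost_liftSteering, hlift]
    exact hle _ (hsub _ ((liftSteering_mem_iff z).mpr hz))
  · intro z hz h
    rw [← relaxedCost_liftSteering, ← relaxedCost_liftSteering, hlift] at h
    have h2 := heq _ (hsub _ ((liftSteering_mem_iff z).mpr hz)) h
    exact Prod.ext (congrArg (fun w => w.1) h2) (congrArg (fun w => w.2.1) h2)
  · obtain ⟨⟨hS0, hSN, hdyn⟩, -⟩ := hsdp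
    refine ⟨hS0, hSN, fun k => ?_⟩
    have h1 := (congrArg (fun w => w.2.2 k) hliftLaw)
    simp only [liftLaw] at h1
    rw [closedLoop_eq k (hSt k)]
    simp only
    rw [h1, hgain]
    exact (sub_eq_zero.mp (hdyn k)).symm
  · intro z hz
    rw [← relaxedCost_liftLaw, ← relaxedCost_liftLaw, hliftLaw]
    exact hle _ (liftLaw_mem h0.posSemidef hz)
  · intro z hz h
    rw [← relaxedCost_liftLaw, ← relaxedCost_liftLaw, hliftLaw] at h
    have h2 := heq _ (liftLaw_mem h0.posSemidef hz) h
    have h3 : z.1 = S := congrArg (fun w => w.1) h2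
    refine Prod.ext h3 (funext fun k => ?_)
    have h4 : z.2 k * z.1 k.castSucc = U k := congrArg (fun w => w.2.1 k) h2
    change z.2 k = U k * (S k.castSucc)⁻¹
    rw [← h4, h3, Matrix.mul_nonsing_inv_cancel_right _ _ (hdet k)]

end Transfer

end CovSteering

theorem mainTheorem5 {n p q : ℕ} (d : CovSteering.SystemData n p q) (N : ℕ) (hN : 0 < N)
    (hA : ∀ k < N, IsUnit (d.A k))
    (hG : (CovSteering.gramian d N).PosDef)
    (hQ : ∀ k < N, (d.Q k).PosSemidef)
    (hR : ∀ k < N, (d.R k).PosDef)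
    (h0 : d.cov0.PosDef)
    (h1 : (d.covN - d.D (N - 1) * (d.D (N - 1))ᵀ).PosDef) :
    -- an optimal solution of the convex problem is an optimal solution of the steering problem,
    -- with `C k = 0`; conversely every optimal solution of the steering problem arises so
    (∀ (S : CovSteering.CovSeq n N) (U : CovSteering.InputSeq n p N)
        (Y : CovSteering.SlackSeq p N),
      CovSteering.IsOptimal (CovSteering.relaxedFeasible d N) (CovSteering.relaxedCost d N)
          (S, U, Y) ↔
        CovSteering.IsOptimal (CovSteering.steeringFeasible d N) (CovSteering.steeringCost d N)
          (S, U) ∧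
        ∀ k : Fin N, CovSteering.gap (S, U, Y) k = 0) ∧
    -- an optimal solution of the convex problem is the only one, for both problems, it is the
    -- only optimal solution of the semidefinite program, and its gains `K k = U k (S k)⁻¹`
    -- are the only optimal steering law
    (∀ (S : CovSteering.CovSeq n N) (U : CovSteering.InputSeq n p N)
        (Y : CovSteering.SlackSeq p N),
      CovSteering.IsOptimal (CovSteering.relaxedFeasible d N) (CovSteering.relaxedCost d N)
          (S, U, Y) →
        (∀ z, CovSteering.IsOptimal (CovSteering.relaxedFeasible d N)
          (CovSteering.relaxedCost d N) z ↔ z = (S, U, Y)) ∧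
        (∀ z, CovSteering.IsOptimal (CovSteering.steeringFeasible d N)
          (CovSteering.steeringCost d N) z ↔ z = (S, U)) ∧
        (∀ z, CovSteering.IsOptimal (CovSteering.sdpFeasible d N)
          (CovSteering.relaxedCost d N) z ↔ z = (S, U, Y)) ∧
        (∀ z, CovSteering.IsOptimal (CovSteering.lawFeasible d N)
          (CovSteering.lawCost d N) z ↔
            z = (S, fun k => U k * (S k.castSucc)⁻¹))) := by
  have hN' : d.covN.PosDef := by
    have h := Matrix.posSemidef_self_mul_conjTranspose (d.D (N - 1))
    rw [Matrix.conjTranspose_eq_transpose_of_trivial] at h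
    simpa using h1.add_posSemidef h
  refine ⟨fun S U Y => ?_, fun S U Y hopt => ?_⟩
  -- If the relaxation is infeasible, lifting shows that the steering problem is too, and both sides
  -- of the equivalence are false.
  · by_cases hne : (CovSteering.relaxedFeasible d N).Nonempty
    · obtain ⟨S₀, U₀, Y₀, hgap, hrel, hste, -, -⟩ :=
        CovSteering.exists_common_optimum hA hQ hR h0 hN' hne
      rw [hrel, hste]
      constructor
      · intro h
        simp only [Prod.mk.injEq] at h
        obtain ⟨rfl, rfl, rfl⟩ := h
        exact ⟨rfl, hgap⟩
      · rintro ⟨h, hg⟩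
        simp only [Prod.mk.injEq] at h
        obtain ⟨rfl, rfl⟩ := h
        have hY : Y = Y₀ := funext fun k =>
          (sub_eq_zero.mp (hg k)).symm.trans (sub_eq_zero.mp (hgap k))
        rw [hY]
    · constructor
      · intro h
        exact absurd ⟨_, h.1⟩ hne
      · rintro ⟨h, -⟩
        exact absurd ⟨_, (CovSteering.liftSteering_mem_iff _).mpr h.1⟩ hne
  · obtain ⟨S₀, U₀, Y₀, -, hrel, hste, hsdp, hlaw⟩ :=
      CovSteering.exists_common_optimum hA hQ hR h0 hN' ⟨_, hopt.1⟩
    have h := (hrel _).mp hopt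
    simp only [Prod.mk.injEq] at h
    obtain ⟨rfl, rfl, rfl⟩ := h
    exact ⟨hrel, hste, hsdp, hlaw⟩
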